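/- Let $d\ge 0$ be an integer, and equip $\mathbb{Z}^d$ with the graph structure in which $x\sim y$ iff $\|x-y\|=1$, where $\|\cdot\|$ is the $\ell^1$ norm. Let $\Gamma\subset\mathbb{Z}^d$ be a set and let $V_0:\mathbb{Z}^d\to\mathbb{R}$ be a function, both invariant under translations by the elements of some subgroup of finite index in $\mathbb{Z}^d$. Let $\mu$ be a Borel probability measure on $\mathbb{R}$ such that 1. for some $\alpha>0$ and $C$, $\mu([t-\epsilon,t+\epsilon])\le C\epsilon^\alpha$ for all $\epsilon>0$ and $t\in\mathbb{R}$; 2. for some $q>0$, $\int|t|^q\,d\mu(t)<\infty$. Let $V$ be a random potential on $\mathbb{Z}^d$ (defined on some probability space) whose values $V(x)$, $x\in\Gamma$, are independent random variables with distribution $\mu$, and such that $V(x)=0$ for $x\notin\Gamma$. For $g\ge 0$ let $H(g)=-\Delta+V_0+gV$ be the (possibly unbounded) operator $$[H(g)\psi](x)=\sum_{y\sim x}(\psi(x)-\psi(y))+(V_0(x)+gV(x))\psi(x)$$ on $\ell^2(\mathbb{Z}^d)$, with the domain $\{\psi\in\ell^2(\mathbb{Z}^d): H(g)\psi\in\ell^2(\mathbb{Z}^d)\}$.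 Let $P_{\Gamma^c}:\ell^2(\mathbb{Z}^d)\to\ell^2(\Gamma^c)$ be the coordinate projection onto the complement $\Gamma^c$ of $\Gamma$, and let $H_\Gamma=P_{\Gamma^c}H(g)P_{\Gamma^c}^*$, an operator on $\ell^2(\Gamma^c)$ which does not depend on $g$ and on $V$. For $z\notin\mathbb{R}$ write $G_z[H](x,y)=\langle\delta_x,(H-z)^{-1}\delta_y\rangle$. Let $\lambda\in\mathbb{R}$ be such that $\lambda\notin\sigma(H_\Gamma)$. Then there exist $0<s<1$, $\eta>0$ and $g_0>0$ such that for all $g\ge g_0$ $$\sup_{\epsilon>0}\ \sup_{x\in\mathbb{Z}^d}\ \sum_{y\in\mathbb{Z}^d}\mathbb{E}\,\big|G_{\lambda+i\epsilon}[H(g)](x,y)\big|^s\,e^{\eta\|x-y\|}<\infty .$$ -/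

import Mathlib

open MeasureTheory ProbabilityTheory
open scoped ENNReal

noncomputable section

namespace TrimmedAnderson

/-- The sites of the lattice `ℤ^d`. -/
abbrev Site (d : ℕ) : Type := Fin d → ℤ

/-- The complex Hilbert space `ℓ²(ι)`. -/
abbrev L2 (ι : Type*) : Type _ := lp (fun _ : ι => ℂ) 2

/-- The `i`-th standard basis vector of `ℤ^d`. The neighbours of a site `x` are `x ± unitVec i`. -/
abbrev unitVec {d : ℕ} (i : Fin d) : Site d := Pi.single i 1

/-- The graph distance (that is, the `ℓ¹` distance) on `ℤ^d`. -/
def graphDist {d : ℕ} (x y : Site d) : ℝ := ∑ i, |((x i : ℝ) - (y i : ℝ))|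

/-! ### Unbounded operators: resolvent set, spectrum, resolvent -/

section Operator

variable {E : Type*} [NormedAddCommGroup E] [NormedSpace ℂ E]

/-- `R` is a bounded two-sided inverse of `A - z : dom A → E`. -/
def IsResolventAt (A : E →ₗ.[ℂ] E) (z : ℂ) (R : E →L[ℂ] E) : Prop :=
  (∀ ψ : A.domain, R (A ψ - z • (ψ : E)) = ψ) ∧
    ∀ φ : E, ∃ h : R φ ∈ A.domain, A ⟨R φ, h⟩ - z • R φ = φ

/-- The resolvent set of a (possibly unbounded) operator. -/
def opResolventSet (A : E →ₗ.[ℂ] E) : Set ℂ := {z | ∃ R : E →L[ℂ] E, IsResolventAt A z R}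

/-- The spectrum of a (possibly unbounded) operator. -/
def opSpectrum (A : E →ₗ.[ℂ] E) : Set ℂ := (opResolventSet A)ᶜ

open Classical in
/-- The resolvent `(A - z)⁻¹`, for `z` in the resolvent set (and `0` for other `z`). -/
def opResolvent (A : E →ₗ.[ℂ] E) (z : ℂ) : E →L[ℂ] E :=
  if h : ∃ R : E →L[ℂ] E, IsResolventAt A z R then h.choose else 0

/-- On the resolvent set, `opResolvent A z` is the inverse of `A - z`. -/
theorem isResolventAt_opResolvent {A : E →ₗ.[ℂ] E} {z : ℂ} (h : z ∈ opResolventSet A) :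
    IsResolventAt A z (opResolvent A z) := by
  have h' : ∃ R : E →L[ℂ] E, IsResolventAt A z R := h
  rw [opResolvent, dif_pos h']
  exact h'.choose_spec

end Operator

/-- The Green function `⟨δ_x, (A - z)⁻¹ δ_y⟩`. -/
def green {d : ℕ} (A : L2 (Site d) →ₗ.[ℂ] L2 (Site d)) (z : ℂ) (x y : Site d) : ℂ :=
  inner ℂ (lp.single 2 x (1 : ℂ) : L2 (Site d))
    (opResolvent A z (lp.single 2 y (1 : ℂ) : L2 (Site d)))

/-! ### Schrödinger operators -/

/-- The formal Schrödinger operator `-Δ + U`, acting on arbitrary functions on `ℤ^d`: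
`ψ ↦ ∑_{y ∼ x} (ψ x - ψ y) + U x * ψ x`. -/
def schrodingerFormal {d : ℕ} (U : Site d → ℝ) : (Site d → ℂ) →ₗ[ℂ] (Site d → ℂ) where
  toFun ψ x := ∑ i, ((ψ x - ψ (x + unitVec i)) + (ψ x - ψ (x - unitVec i))) + (U x : ℂ) * ψ x
  map_add' ψ φ := by
    funext x
    simp only [Pi.add_apply]
    rw [add_add_add_comm, ← Finset.sum_add_distrib, mul_add]
    congr 1
    exact Finset.sum_congr rfl fun i _ => by ring
  map_smul' c ψ := by
    funext x
    simp only [Pi.smul_apply, smul_eq_mul, RingHom.id_apply, mul_add, Finset.mul_sum]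
    congr 1
    · exact Finset.sum_congr rfl fun i _ => by ring
    · ring

/-- The operator `-Δ + U` on `ℓ²(ℤ^d)`, on its natural domain
`{ψ ∈ ℓ² | (-Δ + U) ψ ∈ ℓ²} = {ψ ∈ ℓ² | U ψ ∈ ℓ²}`. -/
def schrodinger {d : ℕ} (U : Site d → ℝ) : L2 (Site d) →ₗ.[ℂ] L2 (Site d) where
  domain :=
    { carrier := {ψ | Memℓp (schrodingerFormal U ψ) 2}
      add_mem' := by
        intro ψ φ hψ hφ
        simp only [Set.mem_ofPred_eq, lp.coeFn_add, map_add] at *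
        exact hψ.add hφ
      zero_mem' := by
        simp only [Set.mem_ofPred_eq, lp.coeFn_zero, map_zero]
        exact zero_memℓp
      smul_mem' := by
        intro c ψ hψ
        simp only [Set.mem_ofPred_eq, lp.coeFn_smul, map_smul] at *
        exact hψ.const_smul c }
  toFun :=
    { toFun := fun ψ => ⟨schrodingerFormal U (ψ : L2 (Site d)), ψ.2⟩
      map_add' := by
        intro ψ φ
        apply Subtype.ext
        exact map_add (schrodingerFormal U) _ _
      map_smul' := by
        intro c ψ
        apply Subtype.ext
        exact map_smul (schrodingerFormal U) c _ }

/-! ### Restriction of an operator to a subset of the lattice -/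

section Compression

variable {ι : Type*} (X : Set ι)

/-- The coordinate projection `P_X : ℓ²(ι) → ℓ²(X)`. -/
def coordProj : L2 ι →ₗ[ℂ] L2 X where
  toFun ψ := ⟨fun x => ψ x, by
    have h := (memℓp_gen_iff (p := 2) (by simp)).1 (lp.memℓp ψ)
    exact memℓp_gen (h.comp_injective Subtype.val_injective)⟩
  map_add' _ _ := rfl
  map_smul' _ _ := rfl

open Classical in
/-- The adjoint `P_X^* : ℓ²(X) → ℓ²(ι)` of the coordinate projection: extension by zero. -/
def extendZero : L2 X →ₗ[ℂ] L2 ι where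
  toFun φ := ⟨fun x => if h : x ∈ X then φ ⟨x, h⟩ else 0, by
    have h := (memℓp_gen_iff (p := 2) (by simp)).1 (lp.memℓp φ)
    refine memℓp_gen ?_
    refine (Function.Injective.summable_iff (Subtype.val_injective (p := (· ∈ X))) ?_).1 ?_
    · intro x hx
      have hx' : x ∉ X := by simpa using hx
      simp [hx']
    · refine h.congr fun x => ?_
      simp⟩
  map_add' φ ψ := by
    apply Subtype.ext
    funext x
    change (if h : x ∈ X then φ ⟨x, h⟩ + ψ ⟨x, h⟩ else 0) =
      (if h : x ∈ X then φ ⟨x, h⟩ else 0) + (if h : x ∈ X then ψ ⟨x, h⟩ else 0)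
    by_cases h : x ∈ X <;> simp [h]
  map_smul' c φ := by
    apply Subtype.ext
    funext x
    by_cases h : x ∈ X <;> simp [h]

/-- The restriction `P_X A P_X^*` of an operator `A` on `ℓ²(ι)` to `ℓ²(X)`. -/
def restriction (A : L2 ι →ₗ.[ℂ] L2 ι) : L2 X →ₗ.[ℂ] L2 X where
  domain := A.domain.comap (extendZero X)
  toFun := coordProj X ∘ₗ A.toFun ∘ₗ (extendZero X).restrict (fun _ h => h)

end Compression

/-! ### The trimmed Anderson model -/

/-- The operator `H(g) = -Δ + V₀ + g V`, for one realisation `V` of the random potential. -/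
def hamiltonian {d : ℕ} (V₀ V : Site d → ℝ) (g : ℝ) : L2 (Site d) →ₗ.[ℂ] L2 (Site d) :=
  schrodinger fun x => V₀ x + g * V x

/-- The operator `H_Γ = P_{Γᶜ} H P_{Γᶜ}^*`. The random potential vanishes on `Γᶜ`, hence `H` may
be replaced here by `-Δ + V₀`; see `restriction_hamiltonian`. -/
def hGamma {d : ℕ} (Γ : Set (Site d)) (V₀ : Site d → ℝ) : L2 ↥Γᶜ →ₗ.[ℂ] L2 ↥Γᶜ :=
  restriction Γᶜ (schrodinger V₀)

/-- The random potential `V` vanishes outside `Γ`, and its values at the sites of `Γ` are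
independent with common distribution `μ`. -/
structure IsTrimmedPotential {d : ℕ} {Ω : Type*} [MeasurableSpace Ω] (Γ : Set (Site d))
    (μ : Measure ℝ) (P : Measure Ω) (V : Ω → Site d → ℝ) : Prop where
  measurable : ∀ x ∈ Γ, Measurable fun ω => V ω x
  law : ∀ x ∈ Γ, P.map (fun ω => V ω x) = μ
  indep : iIndepFun (fun (x : Γ) ω => V ω x) P
  eq_zero : ∀ x ∉ Γ, ∀ ω, V ω x = 0

/-- `Γ` and `V₀` are invariant under a subgroup of finite index in `ℤ^d`. -/
def IsPeriodic {d : ℕ} (Γ : Set (Site d)) (V₀ : Site d → ℝ) : Prop :=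
  ∃ G : AddSubgroup (Site d), G.FiniteIndex ∧
    ∀ v ∈ G, ∀ x, (x + v ∈ Γ ↔ x ∈ Γ) ∧ V₀ (x + v) = V₀ x

/-- `μ` is `α`-regular for some `α > 0`. -/
def IsRegular (μ : Measure ℝ) : Prop :=
  ∃ α : ℝ, 0 < α ∧ ∃ C : ℝ, ∀ ε : ℝ, 0 < ε → ∀ t : ℝ,
    μ (Set.Icc (t - ε) (t + ε)) ≤ ENNReal.ofReal (C * ε ^ α)

/-- `μ` has a finite absolute moment of some order `q > 0`. -/
def HasFiniteMoment (μ : Measure ℝ) : Prop :=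
  ∃ q : ℝ, 0 < q ∧ ∫⁻ t, ENNReal.ofReal (|t| ^ q) ∂μ < ∞

/-- The fractional moment bound at energy `E`, with exponent `s` and decay rate `η`:
`sup_{ε > 0} sup_x ∑_y 𝔼 |G_{E + iε}[H](x, y)|^s e^{η ‖x - y‖} < ∞`. -/
def FractionalMomentBound {d : ℕ} {Ω : Type*} [MeasurableSpace Ω] (P : Measure Ω)
    (H : Ω → (L2 (Site d) →ₗ.[ℂ] L2 (Site d))) (E s η : ℝ) : Prop :=
  (⨆ (ε : ℝ) (_ : 0 < ε) (x : Site d), ∑' y : Site d,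
    (∫⁻ ω, ‖green (H ω) ((E : ℂ) + (ε : ℂ) * Complex.I) x y‖ₑ ^ s ∂P) *
      ENNReal.ofReal (Real.exp (η * graphDist x y))) < ∞

/-! ### Well-definedness -/

/-- The restriction of `H(g)` to `Γᶜ` does not depend on `g` and on the random potential. -/
theorem restriction_hamiltonian {d : ℕ} (Γ : Set (Site d)) (V₀ V : Site d → ℝ) (g : ℝ)
    (hV : ∀ x ∉ Γ, V x = 0) : restriction Γᶜ (hamiltonian V₀ V g) = hGamma Γ V₀ := by
  have key : ∀ φ : L2 ↥Γᶜ, schrodingerFormal (fun x => V₀ x + g * V x) (extendZero Γᶜ φ) =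
      schrodingerFormal V₀ (extendZero Γᶜ φ) := by
    intro φ
    funext x
    by_cases hx : x ∈ Γ
    · have h0 : (extendZero Γᶜ φ : Site d → ℂ) x = 0 := by simp [extendZero, hx]
      simp [schrodingerFormal, h0]
    · simp [schrodingerFormal, hV x hx]
  refine LinearPMap.ext (Submodule.ext fun φ => ?_) fun φ h₁ h₂ => ?_
  · change Memℓp _ 2 ↔ Memℓp _ 2
    rw [key]
  · apply Subtype.ext
    funext x
    exact congrFun (key φ) x

section Resolvent

variable {d : ℕ}

theorem memℓp_shift {f : Site d → ℂ} (hf : Memℓp f 2) (v : Site d) :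
    Memℓp (fun x => f (x + v)) 2 := by
  have h := (memℓp_gen_iff (p := 2) (by simp)).1 hf
  exact memℓp_gen (h.comp_injective (add_left_injective v))

theorem summable_mul_conj {f g : Site d → ℂ} (hf : Memℓp f 2) (hg : Memℓp g 2) :
    Summable fun x => g x * (starRingEnd ℂ) (f x) := by
  have h := lp.summable_inner (𝕜 := ℂ) (⟨f, hf⟩ : L2 (Site d)) ⟨g, hg⟩
  simpa [RCLike.inner_apply] using h

theorem tsum_shift (f g : Site d → ℂ) (v : Site d) :
    ∑' x, g (x + v) * (starRingEnd ℂ) (f x) = ∑' x, g x * (starRingEnd ℂ) (f (x - v)) := by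
  rw [← (Equiv.addRight v).tsum_eq fun x => g x * (starRingEnd ℂ) (f (x - v))]
  simp

theorem tsum_schrodingerFormal (U : Site d → ℝ) {f g : Site d → ℂ} (hf : Memℓp f 2)
    (hg : Memℓp g 2) (h : Summable fun x => (U x : ℂ) * (g x * (starRingEnd ℂ) (f x))) :
    ∑' x, schrodingerFormal U g x * (starRingEnd ℂ) (f x) =
      ∑' x, g x * (starRingEnd ℂ) (schrodingerFormal U f x) := by
  have h0 := (summable_mul_conj hf hg).hasSum
  have h1 : ∀ v, HasSum (fun x => g (x + v) * (starRingEnd ℂ) (f x))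
      (∑' x, g x * (starRingEnd ℂ) (f (x - v))) := fun v => by
    rw [← tsum_shift]
    exact (summable_mul_conj hf (memℓp_shift hg v)).hasSum
  have h2 : ∀ v, HasSum (fun x => g x * (starRingEnd ℂ) (f (x + v)))
      (∑' x, g x * (starRingEnd ℂ) (f (x + v))) := fun v =>
    (summable_mul_conj (memℓp_shift hf v) hg).hasSum
  have e1 := (hasSum_sum fun (i : Fin d) (_ : i ∈ Finset.univ) =>
    (h0.sub (h1 (unitVec i))).add (h0.sub (h1 (-unitVec i)))).add h.hasSum
  have e2 := (hasSum_sum fun (i : Fin d) (_ : i ∈ Finset.univ) =>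
    (h0.sub (h2 (unitVec i))).add (h0.sub (h2 (-unitVec i)))).add h.hasSum
  have E1 : ∀ x, schrodingerFormal U g x * (starRingEnd ℂ) (f x) = _ := fun x => by
    refine Eq.trans ?_ (b := ∑ i, (g x * (starRingEnd ℂ) (f x) -
      g (x + unitVec i) * (starRingEnd ℂ) (f x) + (g x * (starRingEnd ℂ) (f x) -
      g (x + -unitVec i) * (starRingEnd ℂ) (f x))) + (U x : ℂ) * (g x * (starRingEnd ℂ) (f x))) rfl
    simp only [schrodingerFormal, LinearMap.coe_mk, AddHom.coe_mk, add_mul, Finset.sum_mul,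
      sub_mul, ← sub_eq_add_neg, mul_assoc]
  have E2 : ∀ x, g x * (starRingEnd ℂ) (schrodingerFormal U f x) = _ := fun x => by
    refine Eq.trans ?_ (b := ∑ i, (g x * (starRingEnd ℂ) (f x) -
      g x * (starRingEnd ℂ) (f (x + unitVec i)) + (g x * (starRingEnd ℂ) (f x) -
      g x * (starRingEnd ℂ) (f (x + -unitVec i)))) +
      (U x : ℂ) * (g x * (starRingEnd ℂ) (f x))) rfl
    simp only [schrodingerFormal, LinearMap.coe_mk, AddHom.coe_mk, map_add, map_sum, map_sub,
      map_mul, Complex.conj_ofReal, mul_add, Finset.mul_sum, mul_sub, ← sub_eq_add_neg]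
    ring
  rw [tsum_congr E1, tsum_congr E2, e1.tsum_eq, e2.tsum_eq]
  congr 1
  refine Finset.sum_congr rfl fun i _ => ?_
  simp only [sub_neg_eq_add, ← sub_eq_add_neg]
  ring

theorem inner_eq_tsum (f g : L2 (Site d)) :
    inner ℂ f g = ∑' x, g x * (starRingEnd ℂ) (f x) := by
  rw [lp.inner_eq_tsum]
  exact tsum_congr fun x => by simp [RCLike.inner_apply]

theorem memℓp_potential (U : Site d → ℝ) {g : Site d → ℂ} (hg : Memℓp g 2)
    (hUg : Memℓp (schrodingerFormal U g) 2) : Memℓp (fun x => (U x : ℂ) * g x) 2 := by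
  have h : ∀ i ∈ (Finset.univ : Finset (Fin d)), Memℓp
      (fun x => (g x - g (x + unitVec i)) + (g x - g (x - unitVec i))) 2 := fun i _ => by
    have h1 := (hg.sub (memℓp_shift hg (unitVec i))).add
      (hg.sub (memℓp_shift hg (-unitVec i)))
    simp only [← sub_eq_add_neg] at h1
    exact h1
  have h2 := hUg.sub (Memℓp.finsetSum _ h)
  refine cast (congrArg (Memℓp · 2) ?_) h2
  funext x
  simp [schrodingerFormal]

theorem inner_schrodinger (U : Site d → ℝ) (ψ φ : (schrodinger U).domain) :
    inner ℂ (schrodinger U ψ) (φ : L2 (Site d)) = inner ℂ (ψ : L2 (Site d)) (schrodinger U φ) := by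
  rw [inner_eq_tsum, inner_eq_tsum]
  refine (tsum_schrodingerFormal U (lp.memℓp (ψ : L2 (Site d))) (lp.memℓp (φ : L2 (Site d)))
    ?_).symm
  refine (summable_mul_conj (lp.memℓp (ψ : L2 (Site d)))
    (memℓp_potential U (lp.memℓp (φ : L2 (Site d))) φ.2)).congr fun x => ?_
  ring

theorem norm_le_schrodinger (U : Site d → ℝ) (z : ℂ) (ψ : (schrodinger U).domain) :
    |z.im| * ‖(ψ : L2 (Site d))‖ ≤ ‖schrodinger U ψ - z • (ψ : L2 (Site d))‖ := by
  have hreal : (inner ℂ (ψ : L2 (Site d)) (schrodinger U ψ)).im = 0 := by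
    have h := inner_schrodinger U ψ ψ
    rw [← inner_conj_symm] at h
    exact Complex.conj_eq_iff_im.1 h
  have him : (inner ℂ (ψ : L2 (Site d)) (schrodinger U ψ - z • (ψ : L2 (Site d)))).im =
      - z.im * ‖(ψ : L2 (Site d))‖ ^ 2 := by
    rw [inner_sub_right, inner_smul_right, inner_self_eq_norm_sq_to_K, Complex.sub_im, hreal]
    simp [← Complex.ofReal_pow]
  have h1 := Complex.abs_im_le_norm
    (inner ℂ (ψ : L2 (Site d)) (schrodinger U ψ - z • (ψ : L2 (Site d))))
  have h2 := norm_inner_le_norm (𝕜 := ℂ) (ψ : L2 (Site d))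
    (schrodinger U ψ - z • (ψ : L2 (Site d)))
  rw [him, abs_mul, abs_neg, abs_of_nonneg (sq_nonneg ‖(ψ : L2 (Site d))‖)] at h1
  rcases (norm_nonneg (ψ : L2 (Site d))).eq_or_lt with h0 | h0
  · rw [← h0]; simp
  · have h3 := h1.trans h2
    rw [pow_two, ← mul_assoc, mul_comm ‖(ψ : L2 (Site d))‖ ‖_ - _‖] at h3
    exact le_of_mul_le_mul_right h3 h0

theorem memℓp_of_finite_support {f : Site d → ℂ} (hf : f.support.Finite) : Memℓp f 2 :=
  (memℓp_zero_iff.2 hf).of_exponent_ge zero_le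

end Resolvent

/-- A number off the real line is in the resolvent set of every Schrödinger operator. -/
theorem mem_opResolventSet_schrodinger {d : ℕ} (U : Site d → ℝ) {z : ℂ} (hz : z.im ≠ 0) :
    z ∈ opResolventSet (schrodinger U) := by
  -- the operator `A - z` on the domain of `A`
  let A := schrodinger U
  let T : A.domain →ₗ[ℂ] L2 (Site d) := A.toFun - z • A.domain.subtype
  have hT : ∀ ψ : A.domain, T ψ = A ψ - z • (ψ : L2 (Site d)) := fun ψ => rfl
  have hc : 0 < |z.im| := abs_pos.2 hz
  have hlow : ∀ ψ : A.domain, ‖(ψ : L2 (Site d))‖ ≤ |z.im|⁻¹ * ‖T ψ‖ := fun ψ => by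
    rw [inv_mul_eq_div, le_div_iff₀ hc, mul_comm, hT]
    exact norm_le_schrodinger U z ψ
  have hinj : Function.Injective T := by
    rw [injective_iff_map_eq_zero]
    intro ψ hψ
    have h := hlow ψ
    rw [hψ, norm_zero, mul_zero] at h
    exact Subtype.ext (norm_le_zero_iff.1 h)
  have hclosed : IsClosed (LinearMap.range T : Set (L2 (Site d))) := by
    refine IsSeqClosed.isClosed fun u φ hu hφ => ?_
    choose ψ hψ using hu
    have hcau : CauchySeq fun n => (ψ n : L2 (Site d)) := by
      rw [Metric.cauchySeq_iff']
      intro ε hε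
      obtain ⟨N, hN⟩ := Metric.cauchySeq_iff'.1 hφ.cauchySeq (|z.im| * ε) (by positivity)
      refine ⟨N, fun n hn => ?_⟩
      have h1 := hlow (ψ n - ψ N)
      have h2 := hN n hn
      rw [map_sub, hψ, hψ, ← dist_eq_norm] at h1
      rw [dist_eq_norm]
      refine lt_of_le_of_lt h1 ?_
      rw [inv_mul_lt_iff₀ hc]
      exact h2
    obtain ⟨χ, hχ⟩ := cauchySeq_tendsto_of_complete hcau
    have hpt : ∀ x, Filter.Tendsto (fun n => (ψ n : L2 (Site d)) x) Filter.atTop (nhds (χ x)) :=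
      fun x => ((lp.evalCLM ℂ (fun _ : Site d => ℂ) 2 x).continuous.tendsto χ).comp hχ
    have hpu : ∀ x, Filter.Tendsto (fun n => u n x) Filter.atTop (nhds (φ x)) :=
      fun x => ((lp.evalCLM ℂ (fun _ : Site d => ℂ) 2 x).continuous.tendsto φ).comp hφ
    have heq : schrodingerFormal U χ = (φ + z • χ : L2 (Site d)) := by
      funext x
      have l1 : Filter.Tendsto (fun n => schrodingerFormal U (ψ n : L2 (Site d)) x) Filter.atTop
          (nhds (schrodingerFormal U χ x)) := by
        refine Filter.Tendsto.add (tendsto_finsetSum _ fun i _ => ?_) ((hpt x).const_mul _)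
        exact ((hpt x).sub (hpt _)).add ((hpt x).sub (hpt _))
      have l2 := (hpu x).add ((hpt x).const_mul z)
      refine tendsto_nhds_unique l1 (l2.congr fun n => ?_)
      have h3 : u n x = (T (ψ n)) x := by rw [hψ]
      rw [h3, hT]
      exact sub_add_cancel _ _
    have hmem : χ ∈ A.domain := by
      change Memℓp (schrodingerFormal U χ) 2
      rw [heq]
      exact lp.memℓp _
    refine ⟨⟨χ, hmem⟩, ?_⟩
    have hA : A ⟨χ, hmem⟩ = φ + z • χ := Subtype.ext heq
    rw [hT, hA, add_sub_cancel_right]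
  have hdense : (LinearMap.range T)ᗮ = ⊥ := by
    rw [Submodule.eq_bot_iff]
    intro φ hφ
    have heq : schrodingerFormal U φ = ((starRingEnd ℂ) z • φ : L2 (Site d)) := by
      funext x
      let δ : L2 (Site d) := lp.single 2 x (1 : ℂ)
      have hδ : ∀ y, y ≠ x → δ y = 0 := fun y hy => lp.single_apply_ne 2 x 1 hy
      have hδx : δ x = 1 := lp.single_apply_self 2 x 1
      have hfin : (schrodingerFormal U δ).support.Finite := by
        refine (((Set.finite_singleton x).union (Set.finite_range fun i => x - unitVec i)).union
          (Set.finite_range fun i => x + unitVec i)).subset fun y hy => ?_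
        by_contra hcon
        simp only [Set.mem_union, Set.mem_singleton_iff, Set.mem_range, not_or, not_exists] at hcon
        obtain ⟨⟨c1, c2⟩, c3⟩ := hcon
        refine hy ?_
        have d1 : ∀ i, δ (y + unitVec i) = 0 := fun i => hδ _ fun h =>
          c2 i (sub_eq_iff_eq_add.2 h.symm)
        have d2 : ∀ i, δ (y - unitVec i) = 0 := fun i => hδ _ fun h =>
          c3 i (sub_eq_iff_eq_add.1 h).symm
        simp [schrodingerFormal, hδ y c1, d1, d2]
      have hmem : δ ∈ A.domain := memℓp_of_finite_support hfin
      have horth : inner ℂ (T ⟨δ, hmem⟩) φ = 0 := hφ _ ⟨_, rfl⟩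
      rw [hT, inner_sub_left, inner_smul_left, sub_eq_zero, inner_eq_tsum, inner_eq_tsum] at horth
      have hsymm := tsum_schrodingerFormal U (lp.memℓp δ) (lp.memℓp φ)
        (summable_of_ne_finset_zero (s := {x}) fun y hy => by
          rw [hδ y (by simpa using hy)]; simp)
      have s1 : ∀ F : Site d → ℂ, ∑' y, F y * (starRingEnd ℂ) (δ y) = F x := fun F => by
        rw [tsum_eq_single x fun y hy => by rw [hδ y hy]; simp, hδx]
        simp
      have s2 := horth
      rw [s1] at hsymm s2
      exact hsymm.trans s2
    have hmem : φ ∈ A.domain := by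
      change Memℓp (schrodingerFormal U φ) 2
      rw [heq]
      exact lp.memℓp _
    have hA : A ⟨φ, hmem⟩ = (starRingEnd ℂ) z • φ := Subtype.ext heq
    have h := norm_le_schrodinger U ((starRingEnd ℂ) z) ⟨φ, hmem⟩
    change _ ≤ ‖A ⟨φ, hmem⟩ - _‖ at h
    rw [hA, sub_self, norm_zero, Complex.conj_im, abs_neg] at h
    exact norm_le_zero_iff.1 (nonpos_of_mul_nonpos_right h hc)
  have hsurj : Function.Surjective T := by
    rw [← LinearMap.range_eq_top]
    have : CompleteSpace (LinearMap.range T) := hclosed.completeSpace_coe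
    exact Submodule.orthogonal_eq_bot_iff.1 hdense
  let S := LinearEquiv.ofBijective T ⟨hinj, hsurj⟩
  have hTS : ∀ φ, T (S.symm φ) = φ := fun φ => S.apply_symm_apply φ
  let R : L2 (Site d) →L[ℂ] L2 (Site d) :=
    (A.domain.subtype ∘ₗ S.symm.toLinearMap).mkContinuous |z.im|⁻¹ fun φ => by
      have h := hlow (S.symm φ)
      rw [hTS] at h
      exact h
  have hR : ∀ φ, R φ = (S.symm φ : L2 (Site d)) := fun φ => rfl
  refine ⟨R, fun ψ => ?_, fun φ => ⟨(S.symm φ).2, hTS φ⟩⟩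
  rw [hR]
  exact congrArg Subtype.val (S.symm_apply_apply ψ)

end TrimmedAnderson

end

/-!
The fractional moment method of Aizenman and Molchanov, combined with the elimination of the sites
where the potential is not random. Fix `z = E + iε`, with `ε > 0`, and a site `y`, and let
`f x = 𝔼 |G_z(x, y)|^s` for a small `s`. Two recursive inequalities for `f` are combined.

* At a site `x ∈ Γ`, the equation for `ψ = G_z(·, y)` reads
  `(g V(x) + 2d + V₀(x) - z) ψ(x) = δ_{xy} + ∑_{u ∼ x} ψ(u)`. As a function of `V(x)`, the value
  `ψ(x)` has the form `p / (V(x) - b)`, where `p` and `b` do not depend on `V(x)`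
  (`exists_green_update_eq_div`), so that the decoupling inequality `exists_decoupling` allows to
  pull the factor `|g V(x) + …|^s`, of order `g^s`, out of the expectation. Therefore
  `f(x) ≤ C g^{-s} (δ_{xy} + ∑_{u ∼ x} f(u))`
  (`IsTrimmedPotential.lintegral_green_le_neighborSum`).
* The restriction of `ψ` to `Γᶜ` is the image under `(H_Γ - z)⁻¹` of a function that is made of
  `δ_y` and of the values of `ψ` on `Γ`. As `E` is not in the spectrum of the self-adjoint operator
  `H_Γ`, the inverse is bounded uniformly in `ε`, and by the Combes–Thomas argument its kernel
  decays exponentially (`exists_elimination`). This bounds `f` off `Γ` by a sum of values of `f` on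
  `Γ`, with exponentially decaying coefficients (`IsTrimmedPotential.lintegral_green_le_tsum`).

For large `g` the two inequalities form a contraction in the weighted norm
`sup_x f(x) e^{η ‖x - y‖}` (`mul_exp_le_of_recursion`). As `f ≤ ε^{-s}`, the norm with a truncated
weight is finite, hence bounded by a constant that depends neither on `ε` and `y` nor on the
truncation. Half of the decay rate is then spent on the summation over `y`.

The expectations make sense because the resolvent is strongly continuous in the potential with
respect to pointwise convergence (`continuous_opResolvent`), hence measurable.
-/

noncomputable section

namespace TrimmedAnderson

variable {d : ℕ}

/-! ### The lattice -/

/-- The sum of the values of `f` over the `2d` neighbours of a site. -/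
def neighborSum {α : Type*} [AddCommMonoid α] (f : Site d → α) (x : Site d) : α :=
  ∑ i, (f (x + unitVec i) + f (x - unitVec i))

theorem schrodingerFormal_eq (U : Site d → ℝ) (ψ : Site d → ℂ) (x : Site d) :
    schrodingerFormal U ψ x = (2 * d + U x) * ψ x - neighborSum ψ x := by
  simp only [schrodingerFormal, neighborSum, LinearMap.coe_mk, AddHom.coe_mk]
  have : ∀ i : Fin d, (ψ x - ψ (x + unitVec i)) + (ψ x - ψ (x - unitVec i)) =
      2 * ψ x - (ψ (x + unitVec i) + ψ (x - unitVec i)) := fun i => by ring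
  rw [Finset.sum_congr rfl fun i _ => this i, Finset.sum_sub_distrib]
  simp
  ring

theorem graphDist_comm (x y : Site d) : graphDist x y = graphDist y x :=
  Finset.sum_congr rfl fun _ _ => abs_sub_comm _ _

theorem graphDist_self (x : Site d) : graphDist x x = 0 := by simp [graphDist]

theorem graphDist_nonneg (x y : Site d) : 0 ≤ graphDist x y :=
  Finset.sum_nonneg fun _ _ => abs_nonneg _

theorem graphDist_triangle (x y z : Site d) : graphDist x z ≤ graphDist x y + graphDist y z := by
  unfold graphDist
  rw [← Finset.sum_add_distrib]
  exact Finset.sum_le_sum fun _ _ => abs_sub_le _ _ _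

theorem graphDist_add_unitVec (x : Site d) (i : Fin d) : graphDist x (x + unitVec i) = 1 := by
  unfold graphDist
  rw [Finset.sum_eq_single i]
  · simp
  · intro j _ hj
    simp [hj]
  · simp

theorem graphDist_sub_unitVec (x : Site d) (i : Fin d) : graphDist x (x - unitVec i) = 1 := by
  have h := graphDist_add_unitVec (x - unitVec i) i
  rwa [sub_add_cancel, graphDist_comm] at h

/-- The exponential weight `e^{m ‖x - v‖}` centred at `x`, truncated at height `K` so that
multiplication by it is a bounded operator. -/
def truncWeight (m K : ℝ) (x v : Site d) : ℝ := min (Real.exp (m * graphDist x v)) K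

theorem truncWeight_pos (m : ℝ) {K : ℝ} (hK : 0 < K) (x v : Site d) : 0 < truncWeight m K x v :=
  lt_min (Real.exp_pos _) hK

theorem truncWeight_le (m K : ℝ) (x v : Site d) : truncWeight m K x v ≤ K := min_le_right _ _

theorem truncWeight_self (m : ℝ) {K : ℝ} (hK : 1 ≤ K) (x : Site d) : truncWeight m K x x = 1 := by
  simp [truncWeight, graphDist_self, hK]

theorem truncWeight_le_exp_mul {m K : ℝ} (hm : 0 ≤ m) (hK : 0 ≤ K) (x u v : Site d) :
    truncWeight m K x v ≤ Real.exp (m * graphDist u v) * truncWeight m K x u := by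
  have h1 : 1 ≤ Real.exp (m * graphDist u v) :=
    Real.one_le_exp (mul_nonneg hm (graphDist_nonneg _ _))
  unfold truncWeight
  rw [mul_min_of_nonneg _ _ (Real.exp_pos _).le, ← Real.exp_add, ← mul_add]
  refine min_le_min (Real.exp_le_exp.2 (mul_le_mul_of_nonneg_left ?_ hm))
    (le_mul_of_one_le_left hK h1)
  rw [add_comm]
  exact graphDist_triangle _ _ _

/-- Between neighbours, the truncated weight varies by a factor of at most `e^m`. -/
theorem abs_truncWeight_sub_le {m K : ℝ} (hm : 0 ≤ m) (hK : 0 ≤ K) (x : Site d) {u v : Site d}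
    (huv : graphDist u v = 1) :
    |truncWeight m K x v - truncWeight m K x u| ≤ (Real.exp m - 1) * truncWeight m K x u := by
  have h1 := truncWeight_le_exp_mul hm hK x u v
  have h2 := truncWeight_le_exp_mul hm hK x v u
  rw [graphDist_comm v u] at h2
  rw [huv, mul_one] at h1 h2
  have h3 : 1 ≤ Real.exp m := Real.one_le_exp hm
  have h0 : 0 ≤ truncWeight m K x u := le_min (Real.exp_pos _).le hK
  rw [abs_le]
  constructor <;> nlinarith

/-- A periodic function takes finitely many values. -/
theorem IsPeriodic.exists_abs_le {Γ : Set (Site d)} {V₀ : Site d → ℝ} (h : IsPeriodic Γ V₀) :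
    ∃ B, ∀ x, |V₀ x| ≤ B := by
  obtain ⟨G, hG, hinv⟩ := h
  have hlift : ∀ a b, QuotientAddGroup.leftRel G a b → V₀ a = V₀ b := fun a b hab => by
    rw [QuotientAddGroup.leftRel_apply] at hab
    have := (hinv _ hab a).2
    rw [← this]
    congr 1
    abel
  let F : Site d ⧸ G → ℝ := Quotient.lift V₀ hlift
  have : Finite (Site d ⧸ G) := G.finite_quotient_of_finiteIndex
  obtain ⟨B, hB⟩ := (Set.finite_range fun q => |F q|).bddAbove
  exact ⟨B, fun x => hB ⟨(x : Site d ⧸ G), rfl⟩⟩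

/-! ### Operators on `ℓ²(ℤ^d)` -/

theorem memℓp_mul {w : Site d → ℂ} {C : ℝ} (hw : ∀ x, ‖w x‖ ≤ C) {ψ : Site d → ℂ}
    (hψ : Memℓp ψ 2) : Memℓp (fun x => w x * ψ x) 2 := by
  have h := (hψ.norm).const_mul C
  refine h.mono fun x => ?_
  rw [norm_mul]
  exact mul_le_mul_of_nonneg_right (hw x) (norm_nonneg _)

/-- Translation of a square-summable function. -/
def shift (v : Site d) (ψ : L2 (Site d)) : L2 (Site d) :=
  ⟨fun x => ψ (x + v), memℓp_shift (lp.memℓp ψ) v⟩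

theorem norm_shift (v : Site d) (ψ : L2 (Site d)) : ‖shift v ψ‖ = ‖ψ‖ := by
  have h2 : (0 : ℝ) < (2 : ℝ≥0∞).toReal := by simp
  rw [lp.norm_eq_tsum_rpow h2, lp.norm_eq_tsum_rpow h2]
  congr 1
  exact (Equiv.addRight v).tsum_eq fun x => ‖ψ x‖ ^ (2 : ℝ≥0∞).toReal

theorem norm_extendZero {ι : Type*} (X : Set ι) (φ : L2 X) : ‖extendZero X φ‖ = ‖φ‖ := by
  have h2 : (0 : ℝ) < (2 : ℝ≥0∞).toReal := by simp
  rw [lp.norm_eq_tsum_rpow h2, lp.norm_eq_tsum_rpow h2]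
  congr 1
  have hsupp : Function.support (fun x => ‖extendZero X φ x‖ ^ (2 : ℝ≥0∞).toReal) ⊆ X := by
    intro x hx
    by_contra hX
    refine hx ?_
    have : extendZero X φ x = 0 := by simp [extendZero, hX]
    simp [this]
  rw [← tsum_subtype_eq_of_support_subset hsupp]
  refine tsum_congr fun x => ?_
  have : extendZero X φ x = φ x := by simp [extendZero]
  rw [this]

/-- The orthogonal projection of `ℓ²(ℤ^d)` onto the functions that vanish on `Γ`. -/
def trim (Γ : Set (Site d)) : L2 (Site d) →ₗ[ℂ] L2 (Site d) := extendZero Γᶜ ∘ₗ coordProj Γᶜ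

theorem trim_apply_of_mem {Γ : Set (Site d)} {x : Site d} (hx : x ∈ Γ) (ψ : L2 (Site d)) :
    trim Γ ψ x = 0 := by simp [trim, extendZero, hx]

theorem trim_apply_of_notMem {Γ : Set (Site d)} {x : Site d} (hx : x ∉ Γ) (ψ : L2 (Site d)) :
    trim Γ ψ x = ψ x := by
  have h : trim Γ ψ x = coordProj Γᶜ ψ ⟨x, hx⟩ := by simp [trim, extendZero, hx]
  exact h

theorem trim_eq_self {Γ : Set (Site d)} {ψ : L2 (Site d)} (h : ∀ x ∈ Γ, ψ x = 0) :
    trim Γ ψ = ψ := by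
  refine Subtype.ext (funext fun x => ?_)
  by_cases hx : x ∈ Γ
  · exact (trim_apply_of_mem hx ψ).trans (h x hx).symm
  · exact trim_apply_of_notMem hx ψ

theorem inner_trim (Γ : Set (Site d)) (φ ψ : L2 (Site d)) :
    inner ℂ (trim Γ φ) ψ = inner ℂ φ (trim Γ ψ) := by
  rw [inner_eq_tsum, inner_eq_tsum]
  refine tsum_congr fun x => ?_
  by_cases hx : x ∈ Γ
  · simp [trim_apply_of_mem hx]
  · simp [trim_apply_of_notMem hx]

theorem norm_trim_le (Γ : Set (Site d)) (ψ : L2 (Site d)) : ‖trim Γ ψ‖ ≤ ‖ψ‖ := by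
  refine lp.norm_mono two_ne_zero fun x => ?_
  by_cases hx : x ∈ Γ
  · simp [trim_apply_of_mem hx]
  · simp [trim_apply_of_notMem hx]

theorem mem_domain_schrodinger {V₀ : Site d → ℝ} {B : ℝ} (hB : ∀ x, |V₀ x| ≤ B)
    (ψ : L2 (Site d)) : ψ ∈ (schrodinger V₀).domain := by
  have h : ∀ i ∈ (Finset.univ : Finset (Fin d)), Memℓp
      (fun x => (ψ x - ψ (x + unitVec i)) + (ψ x - ψ (x - unitVec i))) 2 := fun i _ => by
    have h1 := ((lp.memℓp ψ).sub (memℓp_shift (lp.memℓp ψ) (unitVec i))).add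
      ((lp.memℓp ψ).sub (memℓp_shift (lp.memℓp ψ) (-unitVec i)))
    simp only [← sub_eq_add_neg] at h1
    exact h1
  have h2 := (Memℓp.finsetSum _ h).add
    (memℓp_mul (w := fun x => (V₀ x : ℂ)) (C := B) (by simpa using hB) (lp.memℓp ψ))
  refine cast (congrArg (Memℓp · 2) ?_) h2
  funext x
  simp [schrodingerFormal]

/-- The operator `P_{Γᶜ}^* H_Γ P_{Γᶜ}` on `ℓ²(ℤ^d)`: the operator `H_Γ`, extended by zero to the
functions supported on `Γ`. For a bounded potential it is defined everywhere. -/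
def trimmedOp (Γ : Set (Site d)) {V₀ : Site d → ℝ} {B : ℝ} (hB : ∀ x, |V₀ x| ≤ B) :
    L2 (Site d) →ₗ[ℂ] L2 (Site d) :=
  trim Γ ∘ₗ (schrodinger V₀).toFun ∘ₗ
    (trim Γ).codRestrict _ fun ψ => mem_domain_schrodinger hB (trim Γ ψ)

section TrimmedOp

variable {Γ : Set (Site d)} {V₀ : Site d → ℝ} {B : ℝ} (hB : ∀ x, |V₀ x| ≤ B)

theorem trimmedOp_apply_of_mem {x : Site d} (hx : x ∈ Γ) (ψ : L2 (Site d)) :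
    trimmedOp Γ hB ψ x = 0 := trim_apply_of_mem hx _

theorem trimmedOp_apply_of_notMem {x : Site d} (hx : x ∉ Γ) (ψ : L2 (Site d)) :
    trimmedOp Γ hB ψ x = schrodingerFormal V₀ (trim Γ ψ) x := trim_apply_of_notMem hx _

theorem isSymmetric_trimmedOp : (trimmedOp Γ hB).IsSymmetric := by
  intro φ ψ
  have h := inner_schrodinger V₀ ⟨trim Γ φ, mem_domain_schrodinger hB _⟩
    ⟨trim Γ ψ, mem_domain_schrodinger hB _⟩
  change inner ℂ (trim Γ (schrodinger V₀ ⟨trim Γ φ, mem_domain_schrodinger hB _⟩)) ψ =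
    inner ℂ φ (trim Γ (schrodinger V₀ ⟨trim Γ ψ, mem_domain_schrodinger hB _⟩))
  rw [inner_trim, h, ← inner_trim]

/-- If `E` is in the resolvent set of `H_Γ`, then `H_Γ - E` is bounded below. -/
theorem exists_norm_le_trimmedOp {E : ℂ} (hE : E ∉ opSpectrum (hGamma Γ V₀)) :
    ∃ M : ℝ, 0 < M ∧ ∀ χ : L2 (Site d), (∀ x ∈ Γ, χ x = 0) →
      ‖χ‖ ≤ M * ‖trimmedOp Γ hB χ - E • χ‖ := by
  obtain ⟨R, hR, -⟩ := not_not.1 hE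
  refine ⟨‖R‖ + 1, by positivity, fun χ hχ => ?_⟩
  have hχ' : extendZero Γᶜ (coordProj Γᶜ χ) = χ := trim_eq_self hχ
  have hmem : coordProj Γᶜ χ ∈ (hGamma Γ V₀).domain := mem_domain_schrodinger hB _
  have h1 := hR ⟨coordProj Γᶜ χ, hmem⟩
  have h2 := R.le_opNorm (hGamma Γ V₀ ⟨coordProj Γᶜ χ, hmem⟩ - E • coordProj Γᶜ χ)
  rw [h1, ← norm_extendZero, ← norm_extendZero, hχ', map_sub, map_smul, hχ'] at h2
  refine h2.trans (mul_le_mul (by simp) (le_of_eq ?_) (norm_nonneg _) (by positivity))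
  rfl

/-- Moving the spectral parameter off the real line preserves the lower bound on `H_Γ - E`. -/
theorem norm_trimmedOp_sub_le (E : ℝ) (ε : ℝ) (χ : L2 (Site d)) :
    ‖trimmedOp Γ hB χ - (E : ℂ) • χ‖ ≤
      ‖trimmedOp Γ hB χ - ((E : ℂ) + ε * Complex.I) • χ‖ := by
  set a := trimmedOp Γ hB χ - (E : ℂ) • χ with ha
  have himT : (inner ℂ a χ).im = 0 := by
    have h := isSymmetric_trimmedOp (Γ := Γ) hB χ χ
    rw [← inner_conj_symm] at h
    have h0 : (inner ℂ χ (trimmedOp Γ hB χ)).im = 0 := Complex.conj_eq_iff_im.1 h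
    rw [ha, inner_sub_left, inner_smul_left, inner_self_eq_norm_sq_to_K,
      isSymmetric_trimmedOp hB χ χ, Complex.sub_im, h0]
    simp [← Complex.ofReal_pow]
  have hb : trimmedOp Γ hB χ - ((E : ℂ) + ε * Complex.I) • χ = a - (ε * Complex.I) • χ := by
    rw [ha, add_smul]; abel
  have hsq := norm_sub_sq (𝕜 := ℂ) a ((ε * Complex.I) • χ)
  have hre : RCLike.re (inner ℂ a ((ε * Complex.I) • χ)) = 0 := by
    rw [inner_smul_right]
    simp [himT]
  rw [hb]
  rw [hre] at hsq
  refine le_of_sq_le_sq ?_ (norm_nonneg _) 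
  rw [hsq]
  nlinarith [sq_nonneg ‖(ε * Complex.I) • χ‖]

/-- The operator `H_Γ` is self-adjoint, so that its spectrum is real. -/
theorem exists_trimmedOp_sub_eq {z : ℂ} (hz : z.im ≠ 0) (φ : L2 (Site d)) :
    ∃ ρ : L2 (Site d), trimmedOp Γ hB ρ - z • ρ = φ := by
  let T : L2 (Site d) →L[ℂ] L2 (Site d) :=
    ⟨trimmedOp Γ hB, (isSymmetric_trimmedOp (Γ := Γ) hB).continuous⟩
  have hT : IsSelfAdjoint T := ContinuousLinearMap.isSelfAdjoint_iff_isSymmetric.2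
    (isSymmetric_trimmedOp hB)
  have hspec : z ∉ spectrum ℂ T := fun h => hz (by
    rw [hT.mem_spectrum_eq_re h]; simp)
  rw [spectrum.notMem_iff] at hspec
  obtain ⟨S, hS⟩ := hspec.exists_right_inv
  refine ⟨-(S φ), ?_⟩
  have h := DFunLike.congr_fun hS φ
  change z • S φ - trimmedOp Γ hB (S φ) = φ at h
  rw [map_neg, smul_neg, sub_neg_eq_add, neg_add_eq_sub]
  exact h

end TrimmedOp

/-! ### Singular moments of a regular measure -/

section Decoupling

variable {μ : Measure ℝ}

theorem two_le_add_inv (a : ℝ≥0∞) : 2 ≤ a + a⁻¹ := by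
  rcases eq_or_ne a 0 with rfl | h0
  · simp
  rcases eq_or_ne a ∞ with rfl | h1
  · simp
  lift a to NNReal using h1
  have h : a ≠ 0 := by simpa using h0
  rw [← ENNReal.coe_inv h]
  norm_cast
  have hp : (0 : ℝ) < a := by exact_mod_cast pos_iff_ne_zero.2 h
  have : (2 : ℝ) ≤ a + (a : ℝ)⁻¹ := by
    rw [← sub_nonneg, show (a : ℝ) + (a : ℝ)⁻¹ - 2 = (a - 1) ^ 2 / a by field_simp; ring]
    positivity
  exact_mod_cast this

/-- For small `r`, the singular moments `∫ |t - b|^{-r} dμ` are bounded uniformly in `b`. -/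
theorem IsRegular.exists_lintegral_rpow_neg_le [IsProbabilityMeasure μ] (h : IsRegular μ) :
    ∃ α : ℝ, 0 < α ∧ ∀ r : ℝ, 0 < r → r < α →
      ∃ C : ℝ≥0∞, C ≠ ∞ ∧ ∀ b : ℂ, ∫⁻ t, ‖(t : ℂ) - b‖ₑ ^ (-r) ∂μ ≤ C := by
  obtain ⟨α, hα, C, hC⟩ := h
  refine ⟨α, hα, fun r hr hrα => ?_⟩
  let c : ℕ → ℝ≥0∞ := fun n => ENNReal.ofReal (((2 : ℝ) ^ r) ^ (n + 1))
  let q : ℝ := (2 : ℝ) ^ r * (1 / 2 : ℝ) ^ α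
  have hq0 : 0 ≤ q := by positivity
  have hq1 : q < 1 := by
    have h1 : (1 / 2 : ℝ) ^ α = (2 : ℝ) ^ (-α) := by
      rw [one_div, Real.inv_rpow (by norm_num), Real.rpow_neg (by norm_num)]
    change (2 : ℝ) ^ r * (1 / 2 : ℝ) ^ α < 1
    rw [h1, ← Real.rpow_add (by norm_num)]
    exact Real.rpow_lt_one_of_one_lt_of_neg (by norm_num) (by linarith)
  refine ⟨1 + ∑' n : ℕ, ENNReal.ofReal (2 ^ r * |C| * q ^ n), ?_, fun b => ?_⟩
  · refine ENNReal.add_ne_top.2 ⟨ENNReal.one_ne_top, ?_⟩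
    rw [← ENNReal.ofReal_tsum_of_nonneg (fun n => by positivity)
      ((summable_geometric_of_lt_one hq0 hq1).mul_left _)]
    exact ENNReal.ofReal_ne_top
  let S : ℕ → Set ℝ := fun n => Set.Icc (b.re - (1 / 2) ^ n) (b.re + (1 / 2) ^ n)
  -- dyadic decomposition of `|t - b|^{-r}` around its singularity
  have hpt : ∀ t : ℝ, ‖(t : ℂ) - b‖ₑ ^ (-r) ≤ 1 + ∑' n, (S n).indicator (fun _ => c n) t := by
    intro t
    have hre : |t - b.re| ≤ ‖(t : ℂ) - b‖ := by
      simpa using Complex.abs_re_le_norm ((t : ℂ) - b)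
    have hmem : ∀ n, |t - b.re| ≤ (1 / 2) ^ n → t ∈ S n := fun n hn => by
      rw [abs_le] at hn
      exact ⟨by linarith, by linarith⟩
    have hanti : ∀ x : ℝ, 0 < x → x ≤ ‖(t : ℂ) - b‖ →
        ‖(t : ℂ) - b‖ₑ ^ (-r) ≤ ENNReal.ofReal (x ^ (-r)) := fun x hx hxt => by
      rw [← ofReal_norm, ENNReal.ofReal_rpow_of_pos (hx.trans_le hxt)]
      exact ENNReal.ofReal_le_ofReal (Real.rpow_le_rpow_of_nonpos hx hxt (by linarith))
    rcases lt_or_ge 1 |t - b.re| with h1 | h1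
    · refine (hanti 1 one_pos (h1.le.trans hre)).trans ?_
      simp
    rcases (abs_nonneg (t - b.re)).eq_or_lt with h0 | h0
    · have htop : ∑' n, (S n).indicator (fun _ => c n) t = ∞ := by
        refine top_le_iff.1 ((ENNReal.tsum_const_eq_top_of_ne_zero (α := ℕ) one_ne_zero).ge.trans
          (ENNReal.tsum_le_tsum fun n => ?_))
        rw [Set.indicator_of_mem (hmem n (by rw [← h0]; positivity))]
        rw [← ENNReal.ofReal_one]
        refine ENNReal.ofReal_le_ofReal (one_le_pow₀ (Real.one_le_rpow (by norm_num) hr.le))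
      rw [htop]
      simp
    · obtain ⟨n, hn1, hn2⟩ := exists_nat_pow_near_of_lt_one h0 h1 (y := (1 / 2 : ℝ))
        (by norm_num) (by norm_num)
      refine (hanti _ (by positivity) (hn1.le.trans hre)).trans ?_
      refine le_trans (le_of_eq ?_) ((ENNReal.le_tsum n).trans le_add_self)
      rw [Set.indicator_of_mem (hmem n hn2)]
      congr 1
      rw [Real.rpow_neg (by positivity), one_div, inv_pow, Real.inv_rpow (by positivity), inv_inv,
        ← Real.rpow_natCast, ← Real.rpow_natCast, ← Real.rpow_mul (by norm_num),
        ← Real.rpow_mul (by norm_num), mul_comm]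
  refine (lintegral_mono hpt).trans ?_
  rw [lintegral_add_left measurable_const, lintegral_one, measure_univ,
    lintegral_tsum fun n => (measurable_const.indicator measurableSet_Icc).aemeasurable]
  gcongr with n
  rw [lintegral_indicator_const measurableSet_Icc]
  refine (mul_le_mul_right (hC _ (by positivity) _) _).trans ?_
  rw [← ENNReal.ofReal_mul (by positivity)]
  refine ENNReal.ofReal_le_ofReal ?_
  have e : ((1 / 2 : ℝ) ^ n) ^ α = ((1 / 2 : ℝ) ^ α) ^ n := by
    rw [← Real.rpow_natCast, ← Real.rpow_natCast, ← Real.rpow_mul (by norm_num),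
      ← Real.rpow_mul (by norm_num), mul_comm]
  rw [e, mul_pow, pow_succ]
  calc ((2 : ℝ) ^ r) ^ n * 2 ^ r * (C * ((1 / 2) ^ α) ^ n)
      ≤ ((2 : ℝ) ^ r) ^ n * 2 ^ r * (|C| * ((1 / 2) ^ α) ^ n) := by
        gcongr; exact le_abs_self C
    _ = _ := by ring

theorem HasFiniteMoment.exists_lintegral_rpow_lt_top [IsProbabilityMeasure μ]
    (h : HasFiniteMoment μ) :
    ∃ q : ℝ, 0 < q ∧ ∀ r : ℝ, 0 < r → r ≤ q → ∫⁻ t, (1 + ‖t‖ₑ) ^ r ∂μ < ∞ := by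
  obtain ⟨q, hq, hfin⟩ := h
  refine ⟨min q 1, by positivity, fun r hr hrq => ?_⟩
  have hpt : ∀ t : ℝ, (1 + ‖t‖ₑ) ^ r ≤ 2 + ENNReal.ofReal (|t| ^ q) := fun t => by
    have h1 := ENNReal.rpow_add_le_add_rpow 1 ‖t‖ₑ hr.le (hrq.trans (min_le_right _ _))
    rw [ENNReal.one_rpow] at h1
    refine h1.trans ?_
    rw [← ENNReal.ofReal_rpow_of_nonneg (abs_nonneg t) hq.le, ← Real.norm_eq_abs,
      ofReal_norm, ← one_add_one_eq_two, add_assoc]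
    gcongr
    rcases le_total ‖t‖ₑ 1 with h | h
    · exact (ENNReal.rpow_le_one h hr.le).trans le_self_add
    · exact (ENNReal.rpow_le_rpow_of_exponent_le h (hrq.trans (min_le_left _ _))).trans
        le_add_self
  refine (lintegral_mono hpt).trans_lt ?_
  rw [lintegral_add_left measurable_const, lintegral_const, measure_univ]
  simpa using hfin

/-- The decoupling inequality. By the arithmetic-geometric mean inequality, and with `ν` the measure
`|t - b|^{-s} dμ`, it reduces to `∫ |t - a|^{-s} dν ≤ κ ν(1)`. The latter follows from the
Cauchy–Schwarz inequality, as the singular moments of `μ` at `b` of order `s` and `2s` have the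
order of magnitude of `(1 + |b|)^{-s}` and `(1 + |b|)^{-2s}`. -/
theorem exists_decoupling [IsProbabilityMeasure μ] (hreg : IsRegular μ) (hmom : HasFiniteMoment μ) :
    ∃ s : ℝ, 0 < s ∧ s < 1 ∧ ∃ C : ℝ≥0∞, C ≠ ∞ ∧ ∀ a b : ℂ,
      ∫⁻ t, ‖(t : ℂ) - b‖ₑ ^ (-s) ∂μ ≤ C * ∫⁻ t, ‖(t : ℂ) - a‖ₑ ^ s * ‖(t : ℂ) - b‖ₑ ^ (-s) ∂μ := by
  obtain ⟨α, hα, hsing⟩ := hreg.exists_lintegral_rpow_neg_le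
  obtain ⟨q, hq, hmom⟩ := hmom.exists_lintegral_rpow_lt_top
  obtain ⟨s, hs, hsα, hsq, hs1⟩ : ∃ s : ℝ, 0 < s ∧ 4 * s < α ∧ 4 * s ≤ q ∧ 4 * s ≤ 1 := by
    refine ⟨min (α / 8) (min (q / 4) (1 / 4)), by positivity, ?_, ?_, ?_⟩
    · have := min_le_left (α / 8) (min (q / 4) (1 / 4)); linarith
    · have := (min_le_right (α / 8) (min (q / 4) (1 / 4))).trans (min_le_left _ _); linarith
    · have := (min_le_right (α / 8) (min (q / 4) (1 / 4))).trans (min_le_right _ _); linarith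
  obtain ⟨C₄, hC₄, h₄⟩ := hsing (4 * s) (by linarith) hsα
  obtain ⟨C₂, hC₂, h₂⟩ := hsing (2 * s) (by linarith) (by linarith)
  obtain ⟨C₁, hC₁, h₁⟩ := hsing s hs (by linarith)
  have hm : ∀ (b : ℂ) (r : ℝ), Measurable fun t : ℝ => ‖(t : ℂ) - b‖ₑ ^ r := fun b r => by
    fun_prop
  have hm' : ∀ r : ℝ, Measurable fun t : ℝ => (1 + ‖t‖ₑ) ^ r := fun r => by fun_prop
  set J := ∫⁻ t, (1 + ‖t‖ₑ) ^ (4 * s) ∂μ with hJ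
  have hJ' : J ≠ ∞ := (hmom (4 * s) (by linarith) hsq).ne
  set I := ∫⁻ t, (1 + ‖t‖ₑ) ^ (-s) ∂μ with hI
  have hI0 : I ≠ 0 := by
    rw [hI, ← pos_iff_ne_zero, lintegral_pos_iff_support (hm' _)]
    have : (Function.support fun t : ℝ => (1 + ‖t‖ₑ) ^ (-s)) = Set.univ := by
      ext t
      simp [ENNReal.rpow_eq_zero_iff]
    rw [this]
    simp
  set K := J ^ (1 / 2 : ℝ) * C₄ ^ (1 / 2 : ℝ) + 1 with hK
  have hK' : K ≠ ∞ := by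
    refine ENNReal.add_ne_top.2 ⟨ENNReal.mul_ne_top ?_ ?_, ENNReal.one_ne_top⟩ <;>
    exact ENNReal.rpow_ne_top_of_nonneg (by norm_num) ‹_›
  set Q := C₂ ^ (1 / 2 : ℝ) * K ^ (1 / 2 : ℝ) with hQ
  have hQ' : Q ≠ ∞ := by
    refine ENNReal.mul_ne_top ?_ ?_ <;>
    exact ENNReal.rpow_ne_top_of_nonneg (by norm_num) ‹_›
  set κ := Q / I + 1 with hκ
  have hκ' : κ ≠ ∞ := ENNReal.add_ne_top.2 ⟨ENNReal.div_ne_top hQ' hI0, ENNReal.one_ne_top⟩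
  have hκ0 : κ ≠ 0 := by simp [hκ]
  refine ⟨s, hs, by linarith, κ, hκ', fun a b => ?_⟩
  set β : ℝ≥0∞ := 1 + ‖b‖ₑ with hβ
  have hβ0 : β ≠ 0 := by simp [hβ]
  have hβ' : β ≠ ∞ := by simp [hβ]
  have hβs0 : β ^ s ≠ 0 := by simp [ENNReal.rpow_eq_zero_iff, hβ0, hβ']
  have hβs' : β ^ s ≠ ∞ := ENNReal.rpow_ne_top_of_nonneg hs.le hβ'
  have hte : ∀ t : ℝ, ‖(t : ℂ)‖ₑ = ‖t‖ₑ := fun t => by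
    rw [← ofReal_norm, Complex.norm_real, ofReal_norm]
  set D := ∫⁻ t, ‖(t : ℂ) - b‖ₑ ^ (-s) ∂μ with hD
  -- the second singular moment has order at most `(1 + |b|)^{-2s}`
  have hupper : (∫⁻ t, ‖(t : ℂ) - b‖ₑ ^ (-(2 * s)) ∂μ) * β ^ (2 * s) ≤ K := by
    rw [← lintegral_mul_const _ (hm _ _)]
    have hpt : ∀ t : ℝ, ‖(t : ℂ) - b‖ₑ ^ (-(2 * s)) * β ^ (2 * s) ≤
        ((1 + ‖t‖ₑ) ^ (4 * s)) ^ (1 / 2 : ℝ) * (‖(t : ℂ) - b‖ₑ ^ (-(4 * s))) ^ (1 / 2 : ℝ) + 1 := by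
      intro t
      have h1 : β ≤ (1 + ‖t‖ₑ) + ‖(t : ℂ) - b‖ₑ := by
        rw [hβ, add_assoc, ← hte]
        gcongr
        have := enorm_sub_le (a := (t : ℂ)) (b := (t : ℂ) - b)
        rwa [sub_sub_cancel] at this
      have h2 : β ^ (2 * s) ≤ (1 + ‖t‖ₑ) ^ (2 * s) + ‖(t : ℂ) - b‖ₑ ^ (2 * s) :=
        (ENNReal.rpow_le_rpow h1 (by linarith)).trans
          (ENNReal.rpow_add_le_add_rpow _ _ (by linarith) (by linarith))
      rw [← ENNReal.rpow_mul, ← ENNReal.rpow_mul, show 4 * s * (1 / 2) = 2 * s by ring,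
        show -(4 * s) * (1 / 2) = -(2 * s) by ring]
      refine (mul_le_mul_right h2 _).trans ?_
      rw [mul_add, mul_comm ((1 + ‖t‖ₑ) ^ (2 * s))]
      gcongr
      rw [ENNReal.rpow_neg]
      exact ENNReal.inv_mul_le_one _
    refine (lintegral_mono hpt).trans ?_
    rw [lintegral_add_right _ measurable_const, lintegral_one, measure_univ, hK]
    gcongr
    refine (ENNReal.lintegral_mul_norm_pow_le (hm' _).aemeasurable (hm _ _).aemeasurable
      (by norm_num) (by norm_num) (by norm_num)).trans ?_
    gcongr
    exact h₄ b
  -- the first singular moment has order at least `(1 + |b|)^{-s}`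
  have hlower : I ≤ D * β ^ s := by
    rw [hD, ← lintegral_mul_const _ (hm _ _)]
    refine lintegral_mono fun t => ?_
    have h1 : ‖(t : ℂ) - b‖ₑ ≤ (1 + ‖t‖ₑ) * β := by
      refine (enorm_sub_le).trans ?_
      rw [hte, hβ, show (1 + ‖t‖ₑ) * (1 + ‖b‖ₑ) = ‖t‖ₑ + ‖b‖ₑ + (1 + ‖t‖ₑ * ‖b‖ₑ) by ring]
      exact le_self_add
    have h2 : ((1 + ‖t‖ₑ) * β) ^ (-s) ≤ ‖(t : ℂ) - b‖ₑ ^ (-s) := by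
      rw [ENNReal.rpow_neg, ENNReal.rpow_neg, ENNReal.inv_le_inv]
      exact ENNReal.rpow_le_rpow h1 hs.le
    refine le_trans (le_of_eq ?_) (mul_le_mul_left h2 _)
    rw [ENNReal.mul_rpow_of_ne_top (by simp) hβ', mul_assoc, ENNReal.rpow_neg β,
      ENNReal.inv_mul_cancel hβs0 hβs', mul_one]
  set X := ∫⁻ t, ‖(t : ℂ) - a‖ₑ ^ (-s) * ‖(t : ℂ) - b‖ₑ ^ (-s) ∂μ with hX
  have hXQ : X * β ^ s ≤ Q := by
    have h1 : X ≤ (∫⁻ t, ‖(t : ℂ) - a‖ₑ ^ (-(2 * s)) ∂μ) ^ (1 / 2 : ℝ) *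
        (∫⁻ t, ‖(t : ℂ) - b‖ₑ ^ (-(2 * s)) ∂μ) ^ (1 / 2 : ℝ) := by
      refine le_trans (le_of_eq ?_) (ENNReal.lintegral_mul_norm_pow_le (hm _ _).aemeasurable
        (hm _ _).aemeasurable (by norm_num) (by norm_num) (by norm_num))
      simp only [← ENNReal.rpow_mul]
      rw [show -(2 * s) * (1 / 2) = -s by ring]
    calc X * β ^ s ≤ (∫⁻ t, ‖(t : ℂ) - a‖ₑ ^ (-(2 * s)) ∂μ) ^ (1 / 2 : ℝ) *
        (∫⁻ t, ‖(t : ℂ) - b‖ₑ ^ (-(2 * s)) ∂μ) ^ (1 / 2 : ℝ) * (β ^ (2 * s)) ^ (1 / 2 : ℝ) := by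
          rw [← ENNReal.rpow_mul β, show 2 * s * (1 / 2) = s by ring]
          exact mul_le_mul_left h1 _
      _ ≤ Q := by
          rw [mul_assoc, ← ENNReal.mul_rpow_of_nonneg _ _ (by norm_num)]
          exact mul_le_mul' (ENNReal.rpow_le_rpow (h₂ a) (by norm_num))
            (ENNReal.rpow_le_rpow hupper (by norm_num))
  have hXD : X ≤ κ * D := by
    rw [← ENNReal.mul_le_mul_iff_left hβs0 hβs', mul_assoc]
    calc X * β ^ s ≤ Q := hXQ
      _ = Q / I * I := (ENNReal.div_mul_cancel hI0 (ne_top_of_le_ne_top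
            (ENNReal.mul_ne_top (ne_top_of_le_ne_top hC₁ (h₁ b)) hβs') hlower)).symm
      _ ≤ κ * (D * β ^ s) := by
          gcongr
          exact le_self_add
  set N := ∫⁻ t, ‖(t : ℂ) - a‖ₑ ^ s * ‖(t : ℂ) - b‖ₑ ^ (-s) ∂μ with hN
  -- the bound `2 ≤ κ |t - a|^s + κ⁻¹ |t - a|^{-s}`, integrated against `|t - b|^{-s} dμ`
  have h2 : D + D ≤ κ * N + D := by
    calc D + D = ∫⁻ t, 2 * ‖(t : ℂ) - b‖ₑ ^ (-s) ∂μ := by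
          rw [lintegral_const_mul _ (hm _ _), two_mul]
      _ ≤ ∫⁻ t, κ * (‖(t : ℂ) - a‖ₑ ^ s * ‖(t : ℂ) - b‖ₑ ^ (-s)) +
            κ⁻¹ * (‖(t : ℂ) - a‖ₑ ^ (-s) * ‖(t : ℂ) - b‖ₑ ^ (-s)) ∂μ := by
          refine lintegral_mono fun t => ?_
          rw [← mul_assoc, ← mul_assoc, ← add_mul]
          gcongr
          rw [ENNReal.rpow_neg, ← ENNReal.mul_inv (.inl hκ0) (.inl hκ')]
          exact two_le_add_inv _
      _ = κ * N + κ⁻¹ * X := by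
          rw [lintegral_add_left (by fun_prop), lintegral_const_mul _ (by fun_prop),
            lintegral_const_mul _ (by fun_prop)]
      _ ≤ κ * N + D := by
          gcongr
          calc κ⁻¹ * X ≤ κ⁻¹ * (κ * D) := by gcongr
            _ = D := by rw [← mul_assoc, ENNReal.inv_mul_cancel hκ0 hκ', one_mul]
  exact (ENNReal.add_le_add_iff_right (ne_top_of_le_ne_top hC₁ (h₁ b))).1 h2

end Decoupling

/-! ### Decay of the resolvent of the trimmed operator -/

section Decay

variable {Γ : Set (Site d)} {V₀ : Site d → ℝ} {B : ℝ} (hB : ∀ x, |V₀ x| ≤ B)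

theorem enorm_neighborSum_le (f : Site d → ℂ) (x : Site d) :
    ‖neighborSum f x‖ₑ ≤ neighborSum (fun u => ‖f u‖ₑ) x :=
  (enorm_sum_le _ _).trans (Finset.sum_le_sum fun _ _ => enorm_add_le _ _)

theorem eq_zero_of_trimmedOp_sub_eq {z : ℂ} (hz : z.im ≠ 0) {x : Site d} (hx : x ∉ Γ)
    {ρ : L2 (Site d)} (hρ : trimmedOp Γ hB ρ - z • ρ = lp.single 2 x (1 : ℂ)) :
    ∀ u ∈ Γ, ρ u = 0 := by
  intro u hu
  have h : trimmedOp Γ hB ρ u - z * ρ u = (lp.single 2 x (1 : ℂ) : L2 (Site d)) u := by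
    rw [← hρ]; rfl
  rw [trimmedOp_apply_of_mem hB hu, lp.single_apply_ne 2 x _ (fun h => hx (h ▸ hu)), zero_sub,
    neg_eq_zero, mul_eq_zero] at h
  exact h.resolve_left fun h0 => hz (by simp [h0])

/-- The Combes–Thomas estimate: where `H_Γ - z` is bounded below by `M⁻¹`, the columns of its
inverse decay exponentially, at a rate that only depends on `M` and on the dimension. -/
theorem norm_le_exp_of_trimmedOp_sub_eq {M m : ℝ} {z : ℂ}
    (hlow : ∀ χ : L2 (Site d), (∀ x ∈ Γ, χ x = 0) → ‖χ‖ ≤ M * ‖trimmedOp Γ hB χ - z • χ‖)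
    (hM : 0 ≤ M) (hm : 0 ≤ m) (hmM : M * (2 * d * (Real.exp m - 1)) ≤ 1 / 2) {x : Site d}
    (hx : x ∉ Γ) {ρ : L2 (Site d)} (hρ : trimmedOp Γ hB ρ - z • ρ = lp.single 2 x (1 : ℂ))
    (hρ0 : ∀ u ∈ Γ, ρ u = 0) (v : Site d) :
    ‖ρ v‖ ≤ 2 * M * Real.exp (-(m * graphDist x v)) := by
  suffices h : ∀ K : ℝ, 1 ≤ K → truncWeight m K x v * ‖ρ v‖ ≤ 2 * M by
    have h1 := h (Real.exp (m * graphDist x v))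
      (Real.one_le_exp (mul_nonneg hm (graphDist_nonneg _ _)))
    rw [truncWeight, min_self] at h1
    rwa [Real.exp_neg, ← div_eq_mul_inv, le_div_iff₀' (Real.exp_pos _)]
  intro K hK
  have hK0 : 0 < K := one_pos.trans_le hK
  set w : Site d → ℝ := truncWeight m K x with hw
  have hwpos : ∀ u, 0 < w u := truncWeight_pos m hK0 x
  have hwK : ∀ u, ‖(w u : ℂ)‖ ≤ K := fun u => by
    rw [Complex.norm_real, Real.norm_of_nonneg (hwpos u).le]
    exact truncWeight_le m K x u
  let φ : L2 (Site d) := ⟨fun u => w u * ρ u, memℓp_mul hwK (lp.memℓp ρ)⟩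
  have hφ : ∀ u, φ u = w u * ρ u := fun u => rfl
  -- the contribution of one direction to the commutator of `H_Γ` with the weight
  let D : Site d → L2 (Site d) := fun t => ⟨fun u => (w u - w (u + t)) * ρ (u + t),
    memℓp_mul (C := K + K) (fun u => (norm_sub_le _ _).trans (add_le_add (hwK _) (hwK _)))
      (memℓp_shift (lp.memℓp ρ) t)⟩
  have hD : ∀ t, (∀ u, graphDist (u + t) u = 1) → ‖D t‖ ≤ (Real.exp m - 1) * ‖φ‖ := by
    intro t ht
    have h0 : 0 ≤ Real.exp m - 1 := sub_nonneg.2 (Real.one_le_exp hm)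
    have h1 : ‖shift t (((Real.exp m - 1 : ℝ) : ℂ) • φ)‖ = (Real.exp m - 1) * ‖φ‖ := by
      rw [norm_shift, norm_smul, Complex.norm_real, Real.norm_of_nonneg h0]
    rw [← h1]
    refine lp.norm_mono two_ne_zero fun u => ?_
    change ‖((w u : ℂ) - w (u + t)) * ρ (u + t)‖ ≤
      ‖((Real.exp m - 1 : ℝ) : ℂ) * ((w (u + t) : ℂ) * ρ (u + t))‖
    rw [← mul_assoc, norm_mul, norm_mul]
    gcongr
    rw [← Complex.ofReal_sub, ← Complex.ofReal_mul, Complex.norm_real, Complex.norm_real,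
      Real.norm_eq_abs, Real.norm_of_nonneg (mul_nonneg h0 (hwpos _).le)]
    exact abs_truncWeight_sub_le hm hK0.le x (ht u)
  let c : L2 (Site d) := ∑ i : Fin d, (D (unitVec i) + D (-unitVec i))
  have hc : ‖c‖ ≤ 2 * d * (Real.exp m - 1) * ‖φ‖ := by
    have h1 : ∀ i ∈ (Finset.univ : Finset (Fin d)), ‖D (unitVec i) + D (-unitVec i)‖ ≤
        (Real.exp m - 1) * ‖φ‖ + (Real.exp m - 1) * ‖φ‖ := fun i _ =>
      (norm_add_le _ _).trans (add_le_add
        (hD _ fun u => by rw [graphDist_comm]; exact graphDist_add_unitVec u i)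
        (hD _ fun u => by
          rw [graphDist_comm, ← sub_eq_add_neg]; exact graphDist_sub_unitVec u i))
    refine (norm_sum_le_of_le _ h1).trans (le_of_eq ?_)
    simp
    ring
  have hcu : ∀ u, c u = neighborSum (fun t => ((w u : ℂ) - w t) * ρ t) u := fun u => by
    simp only [c, neighborSum, lp.coeFn_sum, Finset.sum_apply, sub_eq_add_neg]
    rfl
  have hφ0 : ∀ u ∈ Γ, φ u = 0 := fun u hu => by rw [hφ, hρ0 u hu, mul_zero]
  have hcomm : trimmedOp Γ hB φ - z • φ = lp.single 2 x (1 : ℂ) + trim Γ c := by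
    refine Subtype.ext (funext fun u => ?_)
    change trimmedOp Γ hB φ u - z * φ u = (lp.single 2 x (1 : ℂ) : L2 (Site d)) u + trim Γ c u
    have h1 : trimmedOp Γ hB ρ u - z * ρ u = (lp.single 2 x (1 : ℂ) : L2 (Site d)) u := by
      rw [← hρ]; rfl
    have h2 : (w u : ℂ) * (lp.single 2 x (1 : ℂ) : L2 (Site d)) u =
        (lp.single 2 x (1 : ℂ) : L2 (Site d)) u := by
      rcases eq_or_ne u x with rfl | hne
      · rw [hw, truncWeight_self m hK]; simp
      · rw [lp.single_apply_ne 2 x _ hne, mul_zero]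
    by_cases hu : u ∈ Γ
    · rw [trimmedOp_apply_of_mem hB hu, hφ0 u hu, trim_apply_of_mem hu,
        lp.single_apply_ne 2 x _ (fun h => hx (h ▸ hu))]
      simp
    · rw [← h2, ← h1, trimmedOp_apply_of_notMem hB hu, trimmedOp_apply_of_notMem hB hu,
        trim_apply_of_notMem hu, trim_eq_self hφ0, trim_eq_self hρ0, schrodingerFormal_eq,
        schrodingerFormal_eq, hcu, hφ]
      have h3 : neighborSum (fun t => ((w u : ℂ) - w t) * ρ t) u =
          w u * neighborSum ρ u - neighborSum φ u := by
        simp only [neighborSum, Finset.mul_sum, ← Finset.sum_sub_distrib, hφ]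
        exact Finset.sum_congr rfl fun i _ => by ring
      rw [h3]
      ring
  have h1 := hlow φ hφ0
  rw [hcomm] at h1
  have h2 : ‖(lp.single 2 x (1 : ℂ) : L2 (Site d)) + trim Γ c‖ ≤
      1 + 2 * d * (Real.exp m - 1) * ‖φ‖ := by
    refine (norm_add_le _ _).trans (add_le_add ?_ ((norm_trim_le Γ c).trans hc))
    rw [lp.norm_single (by norm_num)]
    simp
  have h3 : ‖φ‖ ≤ 2 * M := by
    have h4 := h1.trans (mul_le_mul_of_nonneg_left h2 hM)
    nlinarith [norm_nonneg φ]
  refine le_trans (le_of_eq ?_) ((lp.norm_apply_le_norm two_ne_zero φ v).trans h3)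
  rw [hφ, norm_mul, Complex.norm_real, Real.norm_of_nonneg (hwpos v).le]

open Classical in
/-- Off `Γ`, a solution of `(-Δ + U - z) ψ = δ_y` is determined by its values on `Γ`, through the
resolvent of `H_Γ`. -/
theorem enorm_le_tsum_of_trimmedOp_sub_eq {z : ℂ} (hz : z.im ≠ 0) {x : Site d} (hx : x ∉ Γ)
    {ρ : L2 (Site d)}
    (hρ : trimmedOp Γ hB ρ - (starRingEnd ℂ) z • ρ = lp.single 2 x (1 : ℂ))
    {U : Site d → ℝ} (hU : ∀ v ∉ Γ, U v = V₀ v) {y : Site d} {ψ : L2 (Site d)}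
    (hψ : ∀ v, schrodingerFormal U ψ v - z * ψ v = if v = y then 1 else 0) :
    ‖ψ x‖ₑ ≤ ∑' v, ‖ρ v‖ₑ * ((if v = y then 1 else 0) +
      neighborSum (fun u => if u ∈ Γ then ‖ψ u‖ₑ else 0) v) := by
  have hρ0 := eq_zero_of_trimmedOp_sub_eq hB (by simpa using hz) hx hρ
  -- `ρ` is a column of the inverse of `H_Γ - z̄`, hence the conjugate of a row of that of `H_Γ - z`
  have h1 : ψ x = inner ℂ ρ (trimmedOp Γ hB ψ - z • ψ) := by
    have h2 : inner ℂ (lp.single 2 x (1 : ℂ) : L2 (Site d)) ψ = ψ x := by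
      rw [lp.inner_single_left]; simp
    rw [← h2, ← hρ, inner_sub_left, inner_smul_left, isSymmetric_trimmedOp hB ρ ψ,
      inner_sub_right, inner_smul_right, Complex.conj_conj]
  rw [h1, inner_eq_tsum]
  refine enorm_tsum_le_tsum_enorm.trans (ENNReal.tsum_le_tsum fun v => ?_)
  rw [enorm_mul, mul_comm, RCLike.enorm_conj]
  by_cases hv : v ∈ Γ
  · simp [hρ0 v hv]
  gcongr
  have h2 : (trimmedOp Γ hB ψ - z • ψ : L2 (Site d)) v = (if v = y then 1 else 0) +
      neighborSum (fun u => if u ∈ Γ then ψ u else 0) v := by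
    change trimmedOp Γ hB ψ v - z * ψ v = _
    rw [trimmedOp_apply_of_notMem hB hv, ← hψ v, schrodingerFormal_eq, schrodingerFormal_eq,
      trim_apply_of_notMem hv, hU v hv]
    have h3 : neighborSum (trim Γ ψ) v =
        neighborSum ψ v - neighborSum (fun u => if u ∈ Γ then ψ u else 0) v := by
      simp only [neighborSum, ← Finset.sum_sub_distrib]
      have h4 : ∀ u, trim Γ ψ u = ψ u - if u ∈ Γ then ψ u else 0 := fun u => by
        by_cases hu : u ∈ Γ
        · simp [trim_apply_of_mem hu, hu]
        · simp [trim_apply_of_notMem hu, hu]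
      exact Finset.sum_congr rfl fun i _ => by rw [h4, h4]; ring
    rw [h3]
    ring
  rw [h2]
  refine (enorm_add_le _ _).trans (add_le_add ?_ ((enorm_neighborSum_le _ _).trans (le_of_eq ?_)))
  · split_ifs <;> simp
  · congr 1
    funext u
    split_ifs <;> simp

open Classical in
/-- Elimination of the sites off `Γ`, with exponentially decaying coefficients that are uniform in
the imaginary part of the energy and do not depend on the potential on `Γ`. -/
theorem exists_elimination {Γ : Set (Site d)} {V₀ : Site d → ℝ} (hinv : IsPeriodic Γ V₀) {E : ℝ}
    (hE : (E : ℂ) ∉ opSpectrum (hGamma Γ V₀)) :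
    ∃ C m : ℝ, 0 < C ∧ 0 < m ∧ ∀ ε : ℝ, 0 < ε → ∀ x ∉ Γ, ∃ ρ : Site d → ℂ,
      (∀ v, ‖ρ v‖ ≤ C * Real.exp (-(m * graphDist x v))) ∧
      ∀ U : Site d → ℝ, (∀ v ∉ Γ, U v = V₀ v) → ∀ (y : Site d) (ψ : L2 (Site d)),
        (∀ v, schrodingerFormal U ψ v - ((E : ℂ) + ε * Complex.I) * ψ v =
          if v = y then 1 else 0) →
        ‖ψ x‖ₑ ≤ ∑' v, ‖ρ v‖ₑ * ((if v = y then 1 else 0) +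
          neighborSum (fun u => if u ∈ Γ then ‖ψ u‖ₑ else 0) v) := by
  obtain ⟨B, hB⟩ := hinv.exists_abs_le
  obtain ⟨M, hM, hlow⟩ := exists_norm_le_trimmedOp hB hE
  obtain ⟨m, hm, hmM⟩ : ∃ m : ℝ, 0 < m ∧ M * (2 * d * (Real.exp m - 1)) ≤ 1 / 2 := by
    -- the rate at which `2d (e^m - 1)`, which bounds the commutator, is at most `(2M)⁻¹`
    refine ⟨Real.log (1 + 1 / (4 * M * (d + 1))), Real.log_pos ?_, ?_⟩
    · have : 0 < 1 / (4 * M * (d + 1)) := by positivity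
      linarith
    · rw [Real.exp_log (by positivity), add_sub_cancel_left]
      field_simp
      linarith
  refine ⟨2 * M, m, by positivity, hm, fun ε hε x hx => ?_⟩
  set z : ℂ := (E : ℂ) + ε * Complex.I with hz
  have hzim : z.im ≠ 0 := by simp [hz, hε.ne']
  have hconj : (starRingEnd ℂ) z = (E : ℂ) + (-ε : ℝ) * Complex.I := by
    simp [hz]
  have hzim' : ((starRingEnd ℂ) z).im ≠ 0 := by simpa using hzim
  obtain ⟨ρ, hρ⟩ := exists_trimmedOp_sub_eq (Γ := Γ) hB hzim' (lp.single 2 x (1 : ℂ))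
  refine ⟨ρ, fun v => norm_le_exp_of_trimmedOp_sub_eq hB (fun χ hχ => ?_) hM.le hm.le hmM hx hρ
    (eq_zero_of_trimmedOp_sub_eq hB hzim' hx hρ) v, fun U hU y ψ hψ =>
    enorm_le_tsum_of_trimmedOp_sub_eq hB hzim hx hρ hU hψ⟩
  rw [hconj]
  exact (hlow χ hχ).trans
    (mul_le_mul_of_nonneg_left (norm_trimmedOp_sub_le hB E (-ε) χ) hM.le)

end Decay

/-! ### The resolvent as a function of the potential -/

section Resolvent

theorem green_eq_apply (A : L2 (Site d) →ₗ.[ℂ] L2 (Site d)) (z : ℂ) (x y : Site d) :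
    green A z x y = opResolvent A z (lp.single 2 y (1 : ℂ)) x := by
  rw [green, lp.inner_single_left]
  simp

theorem exists_schrodinger_opResolvent (U : Site d → ℝ) {z : ℂ} (hz : z.im ≠ 0) (φ : L2 (Site d)) :
    ∃ h : opResolvent (schrodinger U) z φ ∈ (schrodinger U).domain,
      schrodinger U ⟨_, h⟩ - z • opResolvent (schrodinger U) z φ = φ :=
  (isResolventAt_opResolvent (mem_opResolventSet_schrodinger U hz)).2 φ

theorem schrodingerFormal_opResolvent (U : Site d → ℝ) {z : ℂ} (hz : z.im ≠ 0) (φ : L2 (Site d))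
    (v : Site d) : schrodingerFormal U (opResolvent (schrodinger U) z φ) v -
      z * opResolvent (schrodinger U) z φ v = φ v := by
  obtain ⟨h, h1⟩ := exists_schrodinger_opResolvent U hz φ
  exact congrArg (fun ψ : L2 (Site d) => ψ v) h1

theorem norm_opResolvent_le (U : Site d → ℝ) {z : ℂ} (hz : z.im ≠ 0) (φ : L2 (Site d)) :
    ‖opResolvent (schrodinger U) z φ‖ ≤ |z.im|⁻¹ * ‖φ‖ := by
  obtain ⟨h, h1⟩ := exists_schrodinger_opResolvent U hz φ
  have h2 := norm_le_schrodinger U z ⟨_, h⟩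
  rw [h1] at h2
  rwa [inv_mul_eq_div, le_div_iff₀' (abs_pos.2 hz)]

theorem norm_green_le (U : Site d → ℝ) {z : ℂ} (hz : z.im ≠ 0) (x y : Site d) :
    ‖green (schrodinger U) z x y‖ ≤ |z.im|⁻¹ := by
  rw [green_eq_apply]
  refine (lp.norm_apply_le_norm two_ne_zero _ x).trans ((norm_opResolvent_le U hz _).trans ?_)
  rw [lp.norm_single (by norm_num)]
  simp

/-- A square-summable solution of `(-Δ + U - z) ψ = φ` is given by the resolvent. -/
theorem eq_opResolvent (U : Site d → ℝ) {z : ℂ} (hz : z.im ≠ 0) {φ ψ : L2 (Site d)}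
    (h : ∀ v, schrodingerFormal U ψ v - z * ψ v = φ v) :
    ψ = opResolvent (schrodinger U) z φ := by
  have heq : schrodingerFormal U ψ = (φ + z • ψ : L2 (Site d)) :=
    funext fun v => sub_eq_iff_eq_add.1 (h v)
  have hmem : ψ ∈ (schrodinger U).domain := by
    change Memℓp (schrodingerFormal U ψ) 2
    rw [heq]
    exact lp.memℓp _
  have h1 := (isResolventAt_opResolvent (mem_opResolventSet_schrodinger U hz)).1 ⟨ψ, hmem⟩
  have h2 : schrodinger U ⟨ψ, hmem⟩ = φ + z • ψ := Subtype.ext heq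
  rw [h2, add_sub_cancel_right] at h1
  exact h1.symm

/-- The imaginary part of `⟨δ_x, χ⟩`, for `χ = (H - z)⁻¹ δ_x`, is `Im z ‖χ‖²`. -/
theorem green_self_ne_zero (U : Site d → ℝ) {z : ℂ} (hz : z.im ≠ 0) (x : Site d) :
    green (schrodinger U) z x x ≠ 0 := by
  rw [green_eq_apply]
  intro h0
  obtain ⟨h, h1⟩ := exists_schrodinger_opResolvent U hz (lp.single 2 x (1 : ℂ))
  set χ := opResolvent (schrodinger U) z (lp.single 2 x (1 : ℂ)) with hχ
  have hreal : (inner ℂ χ (schrodinger U ⟨χ, h⟩)).im = 0 := by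
    have h2 := inner_schrodinger U ⟨χ, h⟩ ⟨χ, h⟩
    rw [← inner_conj_symm] at h2
    exact Complex.conj_eq_iff_im.1 h2
  have h3 : inner ℂ χ (schrodinger U ⟨χ, h⟩ - z • χ) = 0 := by
    rw [h1, ← inner_conj_symm, lp.inner_single_left, h0]
    simp
  rw [inner_sub_right, inner_smul_right, inner_self_eq_norm_sq_to_K] at h3
  have h4 := congrArg Complex.im h3
  rw [Complex.sub_im, hreal] at h4
  simp [← Complex.ofReal_pow, hz] at h4
  have h5 := schrodingerFormal_opResolvent U hz (lp.single 2 x (1 : ℂ)) x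
  rw [← hχ, h4, lp.single_apply_self] at h5
  simp [schrodingerFormal] at h5

/-- The Green function is a Möbius function of the potential at one site. -/
theorem exists_green_update_eq_div (U : Site d → ℝ) {z : ℂ} (hz : z.im ≠ 0) (x : Site d) :
    ∃ (b : ℂ) (p : Site d → ℂ), ∀ t : ℝ, (t : ℂ) ≠ b ∧
      ∀ y, green (schrodinger (Function.update U x t)) z x y = p y / (t - b) := by
  set D := green (schrodinger U) z x x with hD
  have hD0 : D ≠ 0 := green_self_ne_zero U hz x
  -- for `y = x` the right-hand side is `1`, so that `t` is not the pole
  have key : ∀ (t : ℝ) (y : Site d), green (schrodinger (Function.update U x t)) z x y *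
      (t - (U x - D⁻¹)) = green (schrodinger U) z x y / D := by
    intro t y
    set ψ := opResolvent (schrodinger (Function.update U x t)) z (lp.single 2 y (1 : ℂ)) with hψ
    -- the second resolvent identity, for potentials that differ at the single site `x`
    have h1 : ψ = opResolvent (schrodinger U) z
        (lp.single 2 y (1 : ℂ) - (((t : ℂ) - U x) * ψ x) • lp.single 2 x (1 : ℂ)) := by
      refine eq_opResolvent U hz fun v => ?_
      have h2 := schrodingerFormal_opResolvent (Function.update U x t) hz
        (lp.single 2 y (1 : ℂ)) v
      rw [← hψ, schrodingerFormal_eq] at h2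
      rw [schrodingerFormal_eq]
      change _ = (lp.single 2 y (1 : ℂ) : L2 (Site d)) v -
        (((t : ℂ) - U x) * ψ x) * (lp.single 2 x (1 : ℂ) : L2 (Site d)) v
      rw [← h2]
      rcases eq_or_ne v x with rfl | hv
      · rw [lp.single_apply_self, Function.update_self]
        ring
      · rw [lp.single_apply_ne 2 x _ hv, Function.update_of_ne hv]
        ring
    have h3 : ψ x = green (schrodinger U) z x y - (((t : ℂ) - U x) * ψ x) * D := by
      rw [hD, green_eq_apply, green_eq_apply]
      conv_lhs => rw [h1, map_sub, map_smul]
      rfl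
    rw [green_eq_apply, ← hψ, eq_div_iff hD0]
    have h4 : ψ x * (↑t - (↑(U x) - D⁻¹)) * D = ψ x * (t - U x) * D + ψ x * (D⁻¹ * D) := by ring
    rw [h4, inv_mul_cancel₀ hD0]
    linear_combination h3
  refine ⟨U x - D⁻¹, fun y => green (schrodinger U) z x y / D, fun t => ?_⟩
  have ht : (t : ℂ) - (U x - D⁻¹) ≠ 0 := by
    intro h0
    have h := key t x
    rw [h0, mul_zero, ← hD, div_self hD0] at h
    exact zero_ne_one h
  exact ⟨sub_ne_zero.1 ht, fun y => (eq_div_iff ht).2 (key t y)⟩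

theorem single_mem_domain (U : Site d → ℝ) (x : Site d) :
    (lp.single 2 x (1 : ℂ) : L2 (Site d)) ∈ (schrodinger U).domain := by
  have h0 : (lp.single 2 x (1 : ℂ) : L2 (Site d)) ∈ (schrodinger (0 : Site d → ℝ)).domain :=
    mem_domain_schrodinger (B := 0) (by simp) _
  have h1 : Memℓp (schrodingerFormal 0 (lp.single 2 x (1 : ℂ) : L2 (Site d))) 2 := h0
  have h2 := h1.add (lp.memℓp ((U x : ℂ) • lp.single 2 x (1 : ℂ) : L2 (Site d)))
  change Memℓp (schrodingerFormal U (lp.single 2 x (1 : ℂ) : L2 (Site d))) 2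
  refine cast (congrArg (Memℓp · 2) (funext fun v => ?_)) h2
  rw [Pi.add_apply, schrodingerFormal_eq, schrodingerFormal_eq, lp.coeFn_smul, Pi.smul_apply,
    smul_eq_mul]
  rcases eq_or_ne v x with rfl | hv
  · simp
    ring
  · rw [lp.single_apply_ne 2 x _ hv]
    simp

/-- The finitely supported functions form a core of the Schrödinger operator. -/
theorem dense_span_schrodinger_single (U : Site d → ℝ) {z : ℂ} (hz : z.im ≠ 0) :
    Dense (Submodule.span ℂ (Set.range fun x => schrodinger U ⟨_, single_mem_domain U x⟩ -
      z • lp.single 2 x (1 : ℂ)) : Set (L2 (Site d))) := by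
  rw [Submodule.dense_iff_topologicalClosure_eq_top, Submodule.topologicalClosure_eq_top_iff,
    Submodule.eq_bot_iff]
  intro φ hφ
  have heq : ∀ x, schrodingerFormal U φ x - (starRingEnd ℂ) z * φ x = (0 : L2 (Site d)) x := by
    intro x
    have h1 : inner ℂ (schrodinger U ⟨_, single_mem_domain U x⟩ -
        z • (lp.single 2 x (1 : ℂ) : L2 (Site d))) φ = 0 :=
      (Submodule.mem_orthogonal _ φ).1 hφ _ (Submodule.subset_span ⟨x, rfl⟩)
    have h2 : ∀ F : Site d → ℂ, ∑' y, F y * (starRingEnd ℂ)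
        ((lp.single 2 x (1 : ℂ) : L2 (Site d)) y) = F x := fun F => by
      rw [tsum_eq_single x fun y hy => by rw [lp.single_apply_ne 2 x _ hy]; simp,
        lp.single_apply_self]
      simp
    have hsymm := tsum_schrodingerFormal U
      (lp.memℓp (lp.single 2 x (1 : ℂ) : L2 (Site d))) (lp.memℓp φ)
      (summable_of_ne_finset_zero (s := {x}) fun y hy => by
        rw [lp.single_apply_ne 2 x _ (by simpa using hy)]; simp)
    rw [h2] at hsymm
    rw [inner_sub_left, inner_smul_left, inner_eq_tsum, inner_eq_tsum, h2] at h1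
    rw [hsymm]
    exact h1
  rw [eq_opResolvent U (z := (starRingEnd ℂ) z) (by simpa using hz) heq, map_zero]

/-- Strong resolvent continuity: on vectors, the resolvent is continuous with respect to pointwise
convergence of the potential. -/
theorem continuous_opResolvent {z : ℂ} (hz : z.im ≠ 0) (φ : L2 (Site d)) :
    Continuous fun U : Site d → ℝ => opResolvent (schrodinger U) z φ := by
  rw [continuous_iff_continuousAt]
  intro U₀
  let K : Submodule ℂ (L2 (Site d)) :=
    { carrier := {φ | ContinuousAt (fun U : Site d → ℝ => opResolvent (schrodinger U) z φ) U₀}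
      add_mem' := fun {a b} ha hb => by
        simp only [Set.mem_ofPred_eq, map_add] at *
        exact ha.add hb
      zero_mem' := by
        simp only [Set.mem_ofPred_eq, map_zero]
        exact continuousAt_const
      smul_mem' := fun c a ha => by
        simp only [Set.mem_ofPred_eq, map_smul] at *
        exact ha.const_smul c }
  have hK : Submodule.span ℂ (Set.range fun x => schrodinger U₀ ⟨_, single_mem_domain U₀ x⟩ -
      z • lp.single 2 x (1 : ℂ)) ≤ K := by
    rw [Submodule.span_le]
    rintro _ ⟨x, rfl⟩
    -- on a core vector, the change of the potential only matters at a single site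
    have h1 : ∀ U : Site d → ℝ, opResolvent (schrodinger U) z
        (schrodinger U₀ ⟨_, single_mem_domain U₀ x⟩ - z • lp.single 2 x (1 : ℂ)) =
        lp.single 2 x (1 : ℂ) + ((U₀ x : ℂ) - U x) •
          opResolvent (schrodinger U) z (lp.single 2 x (1 : ℂ)) := by
      intro U
      have h2 := (isResolventAt_opResolvent (mem_opResolventSet_schrodinger U hz)).1
        ⟨_, single_mem_domain U x⟩
      have h3 : schrodinger U₀ ⟨_, single_mem_domain U₀ x⟩ - z • lp.single 2 x (1 : ℂ) =
          (schrodinger U ⟨_, single_mem_domain U x⟩ - z • lp.single 2 x (1 : ℂ)) +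
            ((U₀ x : ℂ) - U x) • lp.single 2 x (1 : ℂ) := by
        refine Subtype.ext (funext fun v => ?_)
        change schrodingerFormal U₀ (lp.single 2 x (1 : ℂ) : L2 (Site d)) v -
          z * (lp.single 2 x (1 : ℂ) : L2 (Site d)) v =
          schrodingerFormal U (lp.single 2 x (1 : ℂ) : L2 (Site d)) v -
          z * (lp.single 2 x (1 : ℂ) : L2 (Site d)) v +
          ((U₀ x : ℂ) - U x) * (lp.single 2 x (1 : ℂ) : L2 (Site d)) v
        rw [schrodingerFormal_eq, schrodingerFormal_eq]
        rcases eq_or_ne v x with rfl | hv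
        · ring
        · rw [lp.single_apply_ne 2 x _ hv]
          ring
      rw [h3, map_add, map_smul, h2]
    change Filter.Tendsto (fun U : Site d → ℝ => opResolvent (schrodinger U) z
      (schrodinger U₀ ⟨_, single_mem_domain U₀ x⟩ - z • lp.single 2 x (1 : ℂ))) (nhds U₀)
      (nhds (opResolvent (schrodinger U₀) z
      (schrodinger U₀ ⟨_, single_mem_domain U₀ x⟩ - z • lp.single 2 x (1 : ℂ))))
    simp only [h1, sub_self, zero_smul, add_zero]
    have h4 : Filter.Tendsto (fun U : Site d → ℝ => ((U₀ x : ℂ) - U x) •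
        opResolvent (schrodinger U) z (lp.single 2 x (1 : ℂ))) (nhds U₀) (nhds 0) := by
      have h5 : Filter.Tendsto (fun U : Site d → ℝ => ‖(U₀ x : ℂ) - U x‖ * |z.im|⁻¹)
          (nhds U₀) (nhds 0) := by
        have h6 : Continuous fun U : Site d → ℝ => ‖(U₀ x : ℂ) - U x‖ * |z.im|⁻¹ := by fun_prop
        simpa using h6.tendsto U₀
      refine squeeze_zero_norm (fun U => ?_) h5
      rw [norm_smul]
      gcongr
      refine (norm_opResolvent_le U hz _).trans ?_
      rw [lp.norm_single (by norm_num)]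
      simp
    simpa using h4.const_add (lp.single 2 x (1 : ℂ))
  rw [Metric.continuousAt_iff']
  intro ε hε
  obtain ⟨χ, hχ, hdist⟩ := (dense_span_schrodinger_single U₀ hz).exists_dist_lt φ
    (ε := |z.im| * (ε / 3)) (by positivity)
  have hlip : ∀ U : Site d → ℝ, dist (opResolvent (schrodinger U) z φ)
      (opResolvent (schrodinger U) z χ) < ε / 3 := fun U => by
    rw [dist_eq_norm, ← map_sub]
    refine (norm_opResolvent_le U hz _).trans_lt ?_
    rwa [inv_mul_lt_iff₀ (abs_pos.2 hz), ← dist_eq_norm]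
  have hχK : ContinuousAt (fun U : Site d → ℝ => opResolvent (schrodinger U) z χ) U₀ := hK hχ
  filter_upwards [Metric.continuousAt_iff'.1 hχK (ε / 3) (by positivity)] with U hU
  have h1 := dist_triangle4 (opResolvent (schrodinger U) z φ) (opResolvent (schrodinger U) z χ)
    (opResolvent (schrodinger U₀) z χ) (opResolvent (schrodinger U₀) z φ)
  have h2 := hlip U₀
  rw [dist_comm] at h2
  linarith [hlip U]

theorem measurable_green {z : ℂ} (hz : z.im ≠ 0) (x y : Site d) :
    Measurable fun U : Site d → ℝ => green (schrodinger U) z x y := by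
  simp only [green_eq_apply]
  exact ((lp.evalCLM ℂ (fun _ : Site d => ℂ) 2 x).continuous.comp
    (continuous_opResolvent hz _)).measurable

end Resolvent

/-! ### Decoupling of one site -/

section Random

variable {Ω : Type*} [MeasurableSpace Ω] {P : Measure Ω} {μ : Measure ℝ} {Γ : Set (Site d)}
  {V : Ω → Site d → ℝ}

theorem IsTrimmedPotential.measurable_eval (hV : IsTrimmedPotential Γ μ P V) (x : Site d) :
    Measurable fun ω => V ω x := by
  by_cases hx : x ∈ Γ
  · exact hV.measurable x hx
  · simp only [hV.eq_zero x hx]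
    exact measurable_const

theorem measurable_update_zero {Ω' : Type*} {m : MeasurableSpace Ω'} {W : Ω' → Site d → ℝ}
    {x : Site d} (h : ∀ v ≠ x, Measurable fun ω => W ω v) :
    Measurable fun ω => Function.update (W ω) x 0 :=
  measurable_pi_iff.2 fun v => by
    rcases eq_or_ne v x with rfl | hv
    · simp
    · simpa [Function.update_of_ne hv] using h v hv

/-- The value of the random potential at a site of `Γ` is independent of its other values. -/
theorem IsTrimmedPotential.indepFun_update (hV : IsTrimmedPotential Γ μ P V) {x : Site d}
    (hx : x ∈ Γ) :
    IndepFun (fun ω => V ω x) (fun ω => Function.update (V ω) x 0) P := by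
  let m : Γ → MeasurableSpace Ω := fun u =>
    MeasurableSpace.comap (fun ω => V ω u) inferInstance
  have hind : Indep (⨆ u ∈ ({⟨x, hx⟩} : Set Γ), m u) (⨆ u ∈ ({⟨x, hx⟩}ᶜ : Set Γ), m u) P :=
    indep_iSup_of_disjoint (m := m) (fun u : Γ => (hV.measurable u u.2).comap_le) hV.indep.iIndep
      disjoint_compl_right
  rw [IndepFun_iff_Indep]
  have hzero := hV.eq_zero
  have hW : ∀ M : MeasurableSpace Ω, (∀ u : Γ, u ∈ ({⟨x, hx⟩}ᶜ : Set Γ) → m u ≤ M) →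
      Measurable[M] fun ω => Function.update (V ω) x 0 := by
    intro M hM
    refine measurable_update_zero fun v hv => ?_
    by_cases hvΓ : v ∈ Γ
    · exact Measurable.of_comap_le (hM ⟨v, hvΓ⟩ (by simpa [Subtype.ext_iff] using hv))
    · rw [show (fun ω => V ω v) = fun _ => 0 from funext (hzero v hvΓ)]
      exact measurable_const
  have hx' : m ⟨x, hx⟩ ≤ ⨆ u ∈ ({⟨x, hx⟩} : Set Γ), m u := le_biSup m rfl
  exact indep_of_indep_of_le_left
    (indep_of_indep_of_le_right hind (hW _ fun u hu => le_biSup m hu).comap_le) hx'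

theorem IsTrimmedPotential.lintegral_eq [IsProbabilityMeasure P] [IsProbabilityMeasure μ]
    (hV : IsTrimmedPotential Γ μ P V) {x : Site d} (hx : x ∈ Γ) {F : ℝ × (Site d → ℝ) → ℝ≥0∞}
    (hF : Measurable F) :
    ∫⁻ ω, F (V ω x, Function.update (V ω) x 0) ∂P =
      ∫⁻ w, ∫⁻ t, F (t, w) ∂μ ∂(P.map fun ω => Function.update (V ω) x 0) := by
  have hm1 : Measurable fun ω => V ω x := hV.measurable_eval x
  have hm2 : Measurable fun ω => Function.update (V ω) x 0 :=
    measurable_update_zero fun v _ => hV.measurable_eval v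
  have h := (indepFun_iff_map_prod_eq_prod_map_map hm1.aemeasurable hm2.aemeasurable).1
    (hV.indepFun_update hx)
  have : IsProbabilityMeasure (P.map fun ω => Function.update (V ω) x 0) :=
    Measure.isProbabilityMeasure_map hm2.aemeasurable
  rw [← lintegral_map hF (hm1.prodMk hm2), h, hV.law x hx, lintegral_prod_symm _ hF.aemeasurable]

/-- The decoupling inequality for the Green function: the factor `|V(x) - a|^s` may be pulled out
of a fractional moment. -/
theorem IsTrimmedPotential.lintegral_green_le [IsProbabilityMeasure P] [IsProbabilityMeasure μ]
    (hV : IsTrimmedPotential Γ μ P V) {s : ℝ} (hs : 0 < s) {C : ℝ≥0∞}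
    (hdec : ∀ a b : ℂ, ∫⁻ t, ‖(t : ℂ) - b‖ₑ ^ (-s) ∂μ ≤
      C * ∫⁻ t, ‖(t : ℂ) - a‖ₑ ^ s * ‖(t : ℂ) - b‖ₑ ^ (-s) ∂μ)
    (V₀ : Site d → ℝ) {g : ℝ} (hg : 0 < g) {z : ℂ} (hz : z.im ≠ 0) {x : Site d} (hx : x ∈ Γ)
    (y : Site d) (a : ℂ) :
    ∫⁻ ω, ‖green (hamiltonian V₀ (V ω) g) z x y‖ₑ ^ s ∂P ≤
      C * ∫⁻ ω, ‖(V ω x : ℂ) - a‖ₑ ^ s * ‖green (hamiltonian V₀ (V ω) g) z x y‖ₑ ^ s ∂P := by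
  let Φ : ℝ × (Site d → ℝ) → Site d → ℝ := fun p v => V₀ v + g * Function.update p.2 x p.1 v
  have hΦ : Measurable Φ := measurable_pi_iff.2 fun v => by
    rcases eq_or_ne v x with rfl | hv
    · simp only [Φ, Function.update_self]; fun_prop
    · simp only [Φ, Function.update_of_ne hv]; fun_prop
  let F : ℝ × (Site d → ℝ) → ℝ≥0∞ := fun p => ‖green (schrodinger (Φ p)) z x y‖ₑ ^ s
  have hF : Measurable F := (((measurable_green hz x y).comp hΦ).enorm).pow_const s
  have hFω : ∀ ω, ‖green (hamiltonian V₀ (V ω) g) z x y‖ₑ ^ s =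
      F (V ω x, Function.update (V ω) x 0) := fun ω => by
    simp only [F, Φ, Function.update_idem, Function.update_eq_self, hamiltonian]
  have hF' : Measurable fun p : ℝ × (Site d → ℝ) => ‖(p.1 : ℂ) - a‖ₑ ^ s * F p :=
    Measurable.mul (by fun_prop) hF
  have e1 := hV.lintegral_eq hx hF
  have e2 := hV.lintegral_eq hx hF'
  simp only [hFω]
  rw [e1, e2, ← lintegral_const_mul _ hF'.lintegral_prod_left']
  refine lintegral_mono fun w => ?_
  obtain ⟨b, p, hp⟩ := exists_green_update_eq_div (Φ (0, w)) hz x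
  have hgc : (g : ℂ) ≠ 0 := by exact_mod_cast hg.ne'
  have hΦt : ∀ t, Φ (t, w) = Function.update (Φ (0, w)) x (V₀ x + g * t) := fun t => by
    funext v
    rcases eq_or_ne v x with rfl | hv
    · simp [Φ]
    · simp [Φ, Function.update_of_ne hv]
  have hFt : ∀ t : ℝ, F (t, w) = ‖p y / g‖ₑ ^ s * ‖(t : ℂ) - (b - V₀ x) / g‖ₑ ^ (-s) := by
    intro t
    obtain ⟨h1, h2⟩ := hp (V₀ x + g * t)
    have h3 : (t : ℂ) - (b - V₀ x) / g ≠ 0 := by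
      intro h0
      refine h1 ?_
      rw [sub_eq_zero, eq_div_iff hgc] at h0
      push_cast
      linear_combination h0
    have h4 : p y / ((V₀ x + g * t : ℝ) - b) = p y / g * ((t : ℂ) - (b - V₀ x) / g)⁻¹ := by
      have h5 : ((V₀ x + g * t : ℝ) - b : ℂ) = g * ((t : ℂ) - (b - V₀ x) / g) := by
        push_cast
        field_simp
        ring
      rw [h5, ← div_div, div_eq_mul_inv (p y / g)]
    simp only [F]
    rw [hΦt, h2, h4, enorm_mul, ENNReal.mul_rpow_of_nonneg _ _ hs.le, enorm_inv h3,
      ENNReal.inv_rpow, ENNReal.rpow_neg]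
  simp only [hFt]
  rw [lintegral_const_mul _ (by fun_prop)]
  simp only [mul_left_comm _ (‖p y / g‖ₑ ^ s)]
  rw [lintegral_const_mul _ (by fun_prop), mul_left_comm C]
  gcongr
  exact hdec _ _

end Random

/-! ### Sums over the lattice -/

theorem finsetSum_rpow_le {ι : Type*} (t : Finset ι) (f : ι → ℝ≥0∞) {s : ℝ} (hs : 0 < s)
    (hs1 : s ≤ 1) : (∑ i ∈ t, f i) ^ s ≤ ∑ i ∈ t, f i ^ s := by
  classical
  induction t using Finset.induction_on with
  | empty => simp [hs]
  | insert a t ha ih =>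
    rw [Finset.sum_insert ha, Finset.sum_insert ha]
    exact (ENNReal.rpow_add_le_add_rpow _ _ hs.le hs1).trans (add_le_add le_rfl ih)

theorem tsum_rpow_le {ι : Type*} (f : ι → ℝ≥0∞) {s : ℝ} (hs : 0 < s) (hs1 : s ≤ 1) :
    (∑' i, f i) ^ s ≤ ∑' i, f i ^ s :=
  le_of_tendsto (ENNReal.summable.hasSum.ennrpow_const s) (Filter.Eventually.of_forall fun t =>
    (finsetSum_rpow_le t f hs hs1).trans (ENNReal.sum_le_tsum t))

theorem neighborSum_rpow_le (f : Site d → ℝ≥0∞) (x : Site d) {s : ℝ} (hs : 0 < s) (hs1 : s ≤ 1) :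
    neighborSum f x ^ s ≤ neighborSum (fun u => f u ^ s) x :=
  (finsetSum_rpow_le _ _ hs hs1).trans
    (Finset.sum_le_sum fun _ _ => ENNReal.rpow_add_le_add_rpow _ _ hs.le hs1)

theorem lintegral_neighborSum {Ω : Type*} [MeasurableSpace Ω] (P : Measure Ω)
    {f : Site d → Ω → ℝ≥0∞} (hf : ∀ u, Measurable (f u)) (x : Site d) :
    ∫⁻ ω, neighborSum (fun u => f u ω) x ∂P = neighborSum (fun u => ∫⁻ ω, f u ω ∂P) x := by
  simp only [neighborSum]
  rw [lintegral_finsetSum (f := fun i ω => f (x + unitVec i) ω + f (x - unitVec i) ω) _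
    fun i _ => (hf _).add (hf _)]
  exact Finset.sum_congr rfl fun i _ => lintegral_add_left (hf _) _

theorem measurable_neighborSum {Ω : Type*} [MeasurableSpace Ω] {f : Site d → Ω → ℝ≥0∞}
    (hf : ∀ u, Measurable (f u)) (x : Site d) : Measurable fun ω => neighborSum (fun u => f u ω) x :=
  Finset.measurable_sum _ fun _ _ => (hf _).add (hf _)

/-- If `f u ≤ c` at all neighbours `u` of `x`, then the sum over the neighbours is at most
`2d c`. -/
theorem neighborSum_le {f : Site d → ℝ≥0∞} {x : Site d} {c : ℝ≥0∞}
    (h : ∀ u, graphDist x u = 1 → f u ≤ c) : neighborSum f x ≤ 2 * d * c := by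
  refine (Finset.sum_le_sum (g := fun _ => c + c) fun i _ =>
    add_le_add (h _ (graphDist_add_unitVec x i)) (h _ (graphDist_sub_unitVec x i))).trans
    (le_of_eq ?_)
  simp
  ring

theorem tsum_prod_pi (φ : ℤ → ℝ≥0∞) (n : ℕ) :
    ∑' v : Fin n → ℤ, ∏ i, φ (v i) = (∑' a, φ a) ^ n := by
  induction n with
  | zero => simp
  | succ n ih =>
    rw [← (Fin.consEquiv fun _ => ℤ).tsum_eq]
    have h : ∀ p : ℤ × (Fin n → ℤ), ∏ i, φ ((Fin.consEquiv fun _ => ℤ) p i) =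
        φ p.1 * ∏ i, φ (p.2 i) := fun p => by
      rw [Fin.prod_univ_succ]
      rfl
    rw [tsum_congr h, ENNReal.tsum_prod (f := fun a (v : Fin n → ℤ) => φ a * ∏ i, φ (v i))]
    simp_rw [ENNReal.tsum_mul_left, ENNReal.tsum_mul_right, ih]
    rw [pow_succ, mul_comm]

theorem exists_tsum_exp_graphDist_le {κ : ℝ} (hκ : 0 < κ) :
    ∃ S : ℝ≥0∞, S ≠ ∞ ∧ ∀ x : Site d,
      ∑' v, ENNReal.ofReal (Real.exp (-(κ * graphDist x v))) ≤ S := by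
  let φ : ℤ → ℝ≥0∞ := fun a => ENNReal.ofReal (Real.exp (-(κ * |(a : ℝ)|)))
  refine ⟨(∑' a, φ a) ^ d, ENNReal.pow_ne_top ?_, fun x => le_of_eq ?_⟩
  · have hnat : Summable fun n : ℕ => Real.exp (-(κ * |((n : ℤ) : ℝ)|)) := by
      have h := Real.summable_exp_nat_mul_iff.2 (neg_lt_zero.2 hκ)
      refine h.congr fun n => ?_
      congr 1
      rw [Int.cast_natCast, abs_of_nonneg (Nat.cast_nonneg n)]
      ring
    have hint : Summable fun a : ℤ => Real.exp (-(κ * |(a : ℝ)|)) :=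
      Summable.of_nat_of_neg hnat (by simpa using hnat)
    rw [← ENNReal.ofReal_tsum_of_nonneg (fun _ => (Real.exp_pos _).le) hint]
    exact ENNReal.ofReal_ne_top
  · rw [← tsum_prod_pi, ← (Equiv.addLeft x).tsum_eq]
    refine tsum_congr fun w => ?_
    rw [← ENNReal.ofReal_prod_of_nonneg fun _ _ => (Real.exp_pos _).le, ← Real.exp_sum,
      Finset.sum_neg_distrib, ← Finset.mul_sum]
    congr 4
    exact Finset.sum_congr rfl fun i _ => by simp

/-! ### Exponential decay from a pair of recursive inequalities -/

open Classical in
/-- The contraction argument. On `Γ` the function `f` is small compared to its values at the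
neighbours, and off `Γ` it is controlled by its values on `Γ`; if `f` is bounded and `κ` is small
enough, then `f` decays exponentially, with a bound that does not depend on the bound on `f`. -/
theorem mul_exp_le_of_recursion {Γ : Set (Site d)} {f : Site d → ℝ≥0∞} {F κ A S : ℝ≥0∞} {m η : ℝ}
    (hη : 0 ≤ η) (hηm : η ≤ m) {y : Site d} (hF : F ≠ ∞) (hfF : ∀ x, f x ≤ F)
    (hS : ∀ x : Site d, ∑' v, ENNReal.ofReal (Real.exp (-((m - η) * graphDist x v))) ≤ S)
    (hin : ∀ x ∈ Γ, f x ≤ κ * ((if x = y then 1 else 0) + neighborSum f x))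
    (hout : ∀ x ∉ Γ, f x ≤ ∑' v, A * ENNReal.ofReal (Real.exp (-(m * graphDist x v))) *
      ((if v = y then 1 else 0) + neighborSum (fun u => if u ∈ Γ then f u else 0) v))
    (hκ : (1 + A * S * (2 * d * ENNReal.ofReal (Real.exp η))) *
      (κ * (2 * d * ENNReal.ofReal (Real.exp η))) ≤ 2⁻¹) (x : Site d) :
    f x * ENNReal.ofReal (Real.exp (η * graphDist x y)) ≤
      2 * (A + (1 + A * S * (2 * d * ENNReal.ofReal (Real.exp η))) * κ) := by
  set e := ENNReal.ofReal (Real.exp η) with he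
  set c := 2 * d * e with hc
  suffices h : ∀ K : ℝ, 1 ≤ K → f x * ENNReal.ofReal (truncWeight η K y x) ≤
      2 * (A + (1 + A * S * c) * κ) by
    have h1 := h (Real.exp (η * graphDist y x))
      (Real.one_le_exp (mul_nonneg hη (graphDist_nonneg _ _)))
    rwa [truncWeight, min_self, graphDist_comm] at h1
  intro K hK
  have hK0 : 0 ≤ K := zero_le_one.trans hK
  set W : Site d → ℝ≥0∞ := fun v => ENNReal.ofReal (truncWeight η K y v) with hW
  have hWexp : ∀ u v, W v ≤ ENNReal.ofReal (Real.exp (η * graphDist u v)) * W u := fun u v => by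
    rw [hW, ← ENNReal.ofReal_mul (Real.exp_pos _).le]
    exact ENNReal.ofReal_le_ofReal (truncWeight_le_exp_mul hη hK0 y u v)
  have hWy : W y = 1 := by simp [hW, truncWeight_self η hK]
  have hWδ : ∀ v, (if v = y then (1 : ℝ≥0∞) else 0) * W v = if v = y then 1 else 0 := fun v => by
    split_ifs with h
    · rw [h, hWy, one_mul]
    · rw [zero_mul]
  -- the weight costs a factor `e^η` per step
  have hstep : ∀ (h : Site d → ℝ≥0∞) (n : ℝ≥0∞), (∀ u, h u * W u ≤ n) → ∀ v,
      neighborSum h v * W v ≤ c * n := by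
    intro h n hn v
    have h1 : neighborSum h v * W v = neighborSum (fun u => h u * W v) v := by
      simp only [neighborSum, Finset.sum_mul, add_mul]
    rw [h1, hc, mul_assoc]
    refine neighborSum_le fun u hu => ?_
    have h2 := hWexp u v
    rw [graphDist_comm, hu, mul_one, ← he] at h2
    calc h u * W v ≤ h u * (e * W u) := by gcongr
      _ = e * (h u * W u) := by ring
      _ ≤ e * n := by gcongr; exact hn u
  set N := ⨆ u, f u * W u with hN
  have hfN : ∀ u, f u * W u ≤ N := fun u => le_iSup (fun u => f u * W u) u
  -- this is the reason for the truncation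
  have hNtop : N ≠ ∞ := by
    refine ne_top_of_le_ne_top (ENNReal.mul_ne_top hF (ENNReal.ofReal_ne_top (r := K)))
      (iSup_le fun u => ?_)
    exact mul_le_mul' (hfF u) (ENNReal.ofReal_le_ofReal (truncWeight_le η K y u))
  have h1 : ∀ u ∈ Γ, f u * W u ≤ κ * (1 + c * N) := by
    intro u hu
    calc f u * W u ≤ κ * ((if u = y then 1 else 0) + neighborSum f u) * W u := by
          gcongr; exact hin u hu
      _ = κ * ((if u = y then 1 else 0) + neighborSum f u * W u) := by
          rw [mul_assoc, add_mul, hWδ]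
      _ ≤ κ * (1 + c * N) := by
          refine mul_le_mul_right (add_le_add ?_ (hstep f N hfN u)) _
          split_ifs <;> simp
  have h2 : ∀ u ∉ Γ, f u * W u ≤ A + A * S * c * (κ * (1 + c * N)) := by
    intro u hu
    have h3 : ∀ v, A * ENNReal.ofReal (Real.exp (-(m * graphDist u v))) *
        ((if v = y then 1 else 0) + neighborSum (fun u => if u ∈ Γ then f u else 0) v) * W u ≤
        A * (if v = y then 1 else 0) +
          A * ENNReal.ofReal (Real.exp (-((m - η) * graphDist u v))) *
            (c * (κ * (1 + c * N))) := by
      intro v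
      have h4 := hWexp v u
      have h5 : ENNReal.ofReal (Real.exp (-(m * graphDist u v))) * W u ≤
          ENNReal.ofReal (Real.exp (-((m - η) * graphDist u v))) * W v := by
        refine (mul_le_mul_right h4 _).trans (le_of_eq ?_)
        rw [← mul_assoc, ← ENNReal.ofReal_mul (Real.exp_pos _).le, ← Real.exp_add,
          graphDist_comm v u]
        congr 3
        ring
      calc A * ENNReal.ofReal (Real.exp (-(m * graphDist u v))) *
          ((if v = y then 1 else 0) + neighborSum (fun u => if u ∈ Γ then f u else 0) v) * W u
          = A * (ENNReal.ofReal (Real.exp (-(m * graphDist u v))) * W u) *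
          ((if v = y then 1 else 0) + neighborSum (fun u => if u ∈ Γ then f u else 0) v) := by
            ring
        _ ≤ A * (ENNReal.ofReal (Real.exp (-((m - η) * graphDist u v))) * W v) *
          ((if v = y then 1 else 0) + neighborSum (fun u => if u ∈ Γ then f u else 0) v) := by
            gcongr
        _ = A * ENNReal.ofReal (Real.exp (-((m - η) * graphDist u v))) *
          ((if v = y then 1 else 0) * W v) +
          A * ENNReal.ofReal (Real.exp (-((m - η) * graphDist u v))) *
            (neighborSum (fun u => if u ∈ Γ then f u else 0) v * W v) := by ring
        _ ≤ _ := by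
            rw [hWδ]
            gcongr ?_ * _ + _ * ?_
            · refine mul_le_of_le_one_right' ?_
              rw [ENNReal.ofReal_le_one, Real.exp_le_one_iff, neg_nonpos]
              exact mul_nonneg (sub_nonneg.2 hηm) (graphDist_nonneg _ _)
            · refine hstep _ _ (fun t => ?_) v
              split_ifs with ht
              · exact h1 t ht
              · simp
    calc f u * W u ≤ (∑' v, A * ENNReal.ofReal (Real.exp (-(m * graphDist u v))) *
          ((if v = y then 1 else 0) + neighborSum (fun u => if u ∈ Γ then f u else 0) v)) * W u := by
          gcongr; exact hout u hu
      _ ≤ ∑' v, (A * (if v = y then 1 else 0) +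
          A * ENNReal.ofReal (Real.exp (-((m - η) * graphDist u v))) *
            (c * (κ * (1 + c * N)))) := by
          rw [← ENNReal.tsum_mul_right]
          exact ENNReal.tsum_le_tsum h3
      _ = A + A * (∑' v, ENNReal.ofReal (Real.exp (-((m - η) * graphDist u v)))) *
            (c * (κ * (1 + c * N))) := by
          rw [ENNReal.tsum_add, ENNReal.tsum_mul_left, ENNReal.tsum_mul_right,
            ENNReal.tsum_mul_left, tsum_ite_eq, mul_one]
      _ ≤ A + A * S * (c * (κ * (1 + c * N))) := by gcongr; exact hS u
      _ = _ := by ring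
  have h3 : N ≤ A + (1 + A * S * c) * κ + 2⁻¹ * N := by
    refine iSup_le fun u => ?_
    calc f u * W u ≤ A + (1 + A * S * c) * (κ * (1 + c * N)) := by
          by_cases hu : u ∈ Γ
          · refine (h1 u hu).trans (le_trans ?_ le_add_self)
            rw [add_mul, one_mul]
            exact le_self_add
          · refine (h2 u hu).trans (add_le_add le_rfl ?_)
            rw [add_mul]
            exact le_add_self
      _ = A + (1 + A * S * c) * κ + (1 + A * S * c) * (κ * c) * N := by ring
      _ ≤ _ := by gcongr
  have h4 : 2⁻¹ * N ≤ A + (1 + A * S * c) * κ := by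
    have h5 : 2⁻¹ * N + 2⁻¹ * N ≤ A + (1 + A * S * c) * κ + 2⁻¹ * N := by
      rwa [← add_mul, ENNReal.inv_two_add_inv_two, one_mul]
    exact (ENNReal.add_le_add_iff_right (ENNReal.mul_ne_top (by simp) hNtop)).1 h5
  refine (hfN x).trans ?_
  calc N = 2 * (2⁻¹ * N) := by
        rw [← mul_assoc, ENNReal.mul_inv_cancel two_ne_zero ENNReal.ofNat_ne_top, one_mul]
    _ ≤ _ := by gcongr

/-! ### Fractional moments of the Green function -/

section Moments

variable {Ω : Type*} [MeasurableSpace Ω] {P : Measure Ω} {μ : Measure ℝ} {Γ : Set (Site d)}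
  {V : Ω → Site d → ℝ}

theorem IsTrimmedPotential.measurable_green_rpow (hV : IsTrimmedPotential Γ μ P V)
    (V₀ : Site d → ℝ) (g s : ℝ) {z : ℂ} (hz : z.im ≠ 0) (x y : Site d) :
    Measurable fun ω => ‖green (hamiltonian V₀ (V ω) g) z x y‖ₑ ^ s := by
  have h : Measurable fun ω => (fun v => V₀ v + g * V ω v) := measurable_pi_iff.2 fun v =>
    ((hV.measurable_eval v).const_mul g).const_add (V₀ v)
  exact ((measurable_green hz x y).comp h).enorm.pow_const s

open Classical in
theorem schrodingerFormal_green (U : Site d → ℝ) {z : ℂ} (hz : z.im ≠ 0) (y v : Site d) :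
    schrodingerFormal U (opResolvent (schrodinger U) z (lp.single 2 y (1 : ℂ))) v -
      z * opResolvent (schrodinger U) z (lp.single 2 y (1 : ℂ)) v = if v = y then 1 else 0 := by
  rw [schrodingerFormal_opResolvent U hz]
  split_ifs with h
  · rw [h, lp.single_apply_self]
  · exact lp.single_apply_ne 2 y _ h

open Classical in
/-- At the sites of `Γ`, large disorder makes the fractional moments small compared to the ones at
the neighbouring sites. -/
theorem IsTrimmedPotential.lintegral_green_le_neighborSum [IsProbabilityMeasure P]
    [IsProbabilityMeasure μ] (hV : IsTrimmedPotential Γ μ P V) {s : ℝ} (hs : 0 < s) (hs1 : s ≤ 1)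
    {C : ℝ≥0∞} (hdec : ∀ a b : ℂ, ∫⁻ t, ‖(t : ℂ) - b‖ₑ ^ (-s) ∂μ ≤
      C * ∫⁻ t, ‖(t : ℂ) - a‖ₑ ^ s * ‖(t : ℂ) - b‖ₑ ^ (-s) ∂μ)
    (V₀ : Site d → ℝ) {g : ℝ} (hg : 0 < g) {z : ℂ} (hz : z.im ≠ 0) {x : Site d} (hx : x ∈ Γ)
    (y : Site d) :
    ∫⁻ ω, ‖green (hamiltonian V₀ (V ω) g) z x y‖ₑ ^ s ∂P ≤
      C * (ENNReal.ofReal g ^ s)⁻¹ * ((if x = y then 1 else 0) +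
        neighborSum (fun u => ∫⁻ ω, ‖green (hamiltonian V₀ (V ω) g) z u y‖ₑ ^ s ∂P) x) := by
  have hgc : (g : ℂ) ≠ 0 := by exact_mod_cast hg.ne'
  have hge : ‖(g : ℂ)‖ₑ = ENNReal.ofReal g := by
    rw [← ofReal_norm, Complex.norm_real, Real.norm_of_nonneg hg.le]
  have hm := fun u => hV.measurable_green_rpow V₀ g s hz u y
  refine (hV.lintegral_green_le hs hdec V₀ hg hz hx y (-(2 * d + V₀ x - z) / g)).trans ?_
  rw [mul_assoc]
  gcongr
  have hint : ∫⁻ ω, (ENNReal.ofReal g ^ s)⁻¹ * ((if x = y then 1 else 0) +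
      neighborSum (fun u => ‖green (hamiltonian V₀ (V ω) g) z u y‖ₑ ^ s) x) ∂P =
      (ENNReal.ofReal g ^ s)⁻¹ * ((if x = y then 1 else 0) +
        neighborSum (fun u => ∫⁻ ω, ‖green (hamiltonian V₀ (V ω) g) z u y‖ₑ ^ s ∂P) x) := by
    rw [lintegral_const_mul _ ((measurable_neighborSum hm x).const_add _),
      lintegral_add_left measurable_const, lintegral_neighborSum P hm, lintegral_const,
      measure_univ, mul_one]
  rw [← hint]
  refine lintegral_mono fun ω => ?_
  have h1 := schrodingerFormal_green (fun v => V₀ v + g * V ω v) hz y x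
  rw [schrodingerFormal_eq, ← green_eq_apply] at h1
  have h2 : ∀ u, opResolvent (schrodinger fun v => V₀ v + g * V ω v) z
      (lp.single 2 y (1 : ℂ)) u = green (hamiltonian V₀ (V ω) g) z u y :=
    fun u => (green_eq_apply _ z u y).symm
  have h3 : neighborSum (opResolvent (schrodinger fun v => V₀ v + g * V ω v) z
      (lp.single 2 y (1 : ℂ))) x =
      neighborSum (fun u => green (hamiltonian V₀ (V ω) g) z u y) x := by
    simp only [neighborSum, h2]
  rw [h3] at h1
  have h4 : ((V ω x : ℂ) - -(2 * d + V₀ x - z) / g) * green (hamiltonian V₀ (V ω) g) z x y =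
      (g : ℂ)⁻¹ * ((if x = y then 1 else 0) +
        neighborSum (fun u => green (hamiltonian V₀ (V ω) g) z u y) x) := by
    rw [← h1]
    change _ = (g : ℂ)⁻¹ * (((2 * d + ((V₀ x + g * V ω x : ℝ) : ℂ)) *
      green (hamiltonian V₀ (V ω) g) z x y - _ - z * green (hamiltonian V₀ (V ω) g) z x y) + _)
    push_cast
    field_simp
    ring
  rw [← ENNReal.mul_rpow_of_nonneg _ _ hs.le, ← enorm_mul, h4, enorm_mul,
    ENNReal.mul_rpow_of_nonneg _ _ hs.le, enorm_inv hgc, ENNReal.inv_rpow, hge]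
  gcongr
  refine (ENNReal.rpow_le_rpow (enorm_add_le _ _) hs.le).trans
    ((ENNReal.rpow_add_le_add_rpow _ _ hs.le hs1).trans (add_le_add ?_ ?_))
  · split_ifs <;> simp [hs]
  · exact (ENNReal.rpow_le_rpow (enorm_neighborSum_le _ _) hs.le).trans
      (neighborSum_rpow_le _ _ hs hs1)

open Classical in
/-- Off `Γ`, the fractional moments are controlled by the ones at the sites of `Γ`. -/
theorem IsTrimmedPotential.lintegral_green_le_tsum [IsProbabilityMeasure P]
    (hV : IsTrimmedPotential Γ μ P V) {s : ℝ} (hs : 0 < s) (hs1 : s ≤ 1) (V₀ : Site d → ℝ) (g : ℝ)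
    {z : ℂ} (hz : z.im ≠ 0) {x : Site d} {ρ : Site d → ℂ} (y : Site d)
    (hρ : ∀ U : Site d → ℝ, (∀ v ∉ Γ, U v = V₀ v) → ∀ (y : Site d) (ψ : L2 (Site d)),
        (∀ v, schrodingerFormal U ψ v - z * ψ v = if v = y then 1 else 0) →
        ‖ψ x‖ₑ ≤ ∑' v, ‖ρ v‖ₑ * ((if v = y then 1 else 0) +
          neighborSum (fun u => if u ∈ Γ then ‖ψ u‖ₑ else 0) v)) :
    ∫⁻ ω, ‖green (hamiltonian V₀ (V ω) g) z x y‖ₑ ^ s ∂P ≤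
      ∑' v, ‖ρ v‖ₑ ^ s * ((if v = y then 1 else 0) + neighborSum (fun u =>
        if u ∈ Γ then ∫⁻ ω, ‖green (hamiltonian V₀ (V ω) g) z u y‖ₑ ^ s ∂P else 0) v) := by
  have hm : ∀ u, Measurable fun ω =>
      if u ∈ Γ then ‖green (hamiltonian V₀ (V ω) g) z u y‖ₑ ^ s else 0 := fun u => by
    split_ifs
    · exact hV.measurable_green_rpow V₀ g s hz u y
    · exact measurable_const
  have hpt : ∀ ω, ‖green (hamiltonian V₀ (V ω) g) z x y‖ₑ ^ s ≤
      ∑' v, ‖ρ v‖ₑ ^ s * ((if v = y then 1 else 0) + neighborSum (fun u =>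
        if u ∈ Γ then ‖green (hamiltonian V₀ (V ω) g) z u y‖ₑ ^ s else 0) v) := by
    intro ω
    have h1 := hρ (fun v => V₀ v + g * V ω v) (fun v hv => by simp [hV.eq_zero v hv ω]) y _
      (schrodingerFormal_green _ hz y)
    simp only [← green_eq_apply] at h1
    refine (ENNReal.rpow_le_rpow h1 hs.le).trans ((tsum_rpow_le _ hs hs1).trans
      (ENNReal.tsum_le_tsum fun v => ?_))
    rw [ENNReal.mul_rpow_of_nonneg _ _ hs.le]
    gcongr
    refine (ENNReal.rpow_add_le_add_rpow _ _ hs.le hs1).trans (add_le_add ?_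
      ((neighborSum_rpow_le _ _ hs hs1).trans (le_of_eq ?_)))
    · split_ifs <;> simp [hs]
    · congr 1
      funext u
      split_ifs <;> simp [hs, hamiltonian]
  refine (lintegral_mono hpt).trans (le_of_eq ?_)
  rw [lintegral_tsum fun v =>
    (((measurable_neighborSum hm v).const_add _).const_mul _).aemeasurable]
  refine tsum_congr fun v => ?_
  rw [lintegral_const_mul _ ((measurable_neighborSum hm v).const_add _),
    lintegral_add_left measurable_const, lintegral_neighborSum P hm, lintegral_const, measure_univ,
    mul_one]
  congr 3
  funext u
  split_ifs <;> simp

end Moments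

end TrimmedAnderson
end

open TrimmedAnderson in
theorem mainTheorem1 {d : ℕ} {Ω : Type*} [MeasurableSpace Ω] (P : Measure Ω)
    [IsProbabilityMeasure P] (μ : Measure ℝ) [IsProbabilityMeasure μ]
    (Γ : Set (Site d)) (V₀ : Site d → ℝ) (V : Ω → Site d → ℝ)
    (hV : IsTrimmedPotential Γ μ P V)
    (hinv : IsPeriodic Γ V₀) (hreg₁ : IsRegular μ) (hreg₂ : HasFiniteMoment μ)
    (E : ℝ) (hE : (E : ℂ) ∉ opSpectrum (hGamma Γ V₀)) :
    ∃ s η g₀ : ℝ, 0 < s ∧ s < 1 ∧ 0 < η ∧ 0 < g₀ ∧ ∀ g : ℝ, g₀ ≤ g →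
      FractionalMomentBound P (fun ω => hamiltonian V₀ (V ω) g) E s η := by
  classical
  obtain ⟨s, hs, hs1, C, hC, hdec⟩ := exists_decoupling hreg₁ hreg₂
  obtain ⟨C₁, m, hC₁, hm, helim⟩ := exists_elimination hinv hE
  set M := s * m with hM
  have hM0 : 0 < M := mul_pos hs hm
  set η := M / 2 with hη
  have hη0 : 0 < η := half_pos hM0
  obtain ⟨S, hS, hsum⟩ := exists_tsum_exp_graphDist_le (d := d) (κ := M - η)
    (by rw [hη]; linarith)
  obtain ⟨S', hS', hsum'⟩ := exists_tsum_exp_graphDist_le (d := d) (κ := η / 2) (by linarith)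
  set A := ENNReal.ofReal C₁ ^ s with hA
  have hAtop : A ≠ ∞ := ENNReal.rpow_ne_top_of_nonneg hs.le ENNReal.ofReal_ne_top
  set c : ℝ≥0∞ := 2 * d * ENNReal.ofReal (Real.exp η) with hc
  have hctop : c ≠ ∞ := by
    refine ENNReal.mul_ne_top (ENNReal.mul_ne_top (by simp) (by simp)) ENNReal.ofReal_ne_top
  set B := 1 + A * S * c with hB
  have hBtop : B ≠ ∞ := ENNReal.add_ne_top.2
    ⟨ENNReal.one_ne_top, ENNReal.mul_ne_top (ENNReal.mul_ne_top hAtop hS) hctop⟩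
  -- the disorder has to satisfy `g ^ s ≥ 2 * (B * C * c)`
  set q := 2 * (B * C * c) with hq
  have hqtop : q ≠ ∞ :=
    ENNReal.mul_ne_top (by simp) (ENNReal.mul_ne_top (ENNReal.mul_ne_top hBtop hC) hctop)
  refine ⟨s, η / 2, max 1 (q.toReal ^ s⁻¹), hs, hs1, by linarith, by positivity, fun g hg => ?_⟩
  have hg0 : 0 < g := one_pos.trans_le ((le_max_left _ _).trans hg)
  set G := ENNReal.ofReal g ^ s with hG
  have hG0 : G ≠ 0 := by simp [hG, ENNReal.rpow_eq_zero_iff, hg0]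
  have hGtop : G ≠ ∞ := ENNReal.rpow_ne_top_of_nonneg hs.le ENNReal.ofReal_ne_top
  have hqG : q ≤ G := by
    rw [hG, ENNReal.ofReal_rpow_of_pos hg0, ← ENNReal.ofReal_toReal hqtop]
    refine ENNReal.ofReal_le_ofReal ?_
    have h1 := Real.rpow_le_rpow (by positivity) ((le_max_right _ _).trans hg) hs.le
    rwa [← Real.rpow_mul ENNReal.toReal_nonneg, inv_mul_cancel₀ hs.ne', Real.rpow_one] at h1
  set κ := C * G⁻¹ with hκ
  have hκtop : κ ≠ ∞ := ENNReal.mul_ne_top hC (ENNReal.inv_ne_top.2 hG0)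
  have hsmall : B * (κ * c) ≤ 2⁻¹ := by
    have h1 : B * (κ * c) = 2⁻¹ * (q * G⁻¹) := by
      rw [hq, hκ, ← mul_assoc 2⁻¹, ← mul_assoc 2⁻¹, ENNReal.inv_mul_cancel two_ne_zero (by simp)]
      ring
    rw [h1]
    refine mul_le_of_le_one_right' ?_
    rw [← div_eq_mul_inv]
    exact ENNReal.div_le_of_le_mul (by rwa [one_mul])
  set T := 2 * (A + B * κ) with hT
  have hTtop : T ≠ ∞ := ENNReal.mul_ne_top (by simp)
    (ENNReal.add_ne_top.2 ⟨hAtop, ENNReal.mul_ne_top hBtop hκtop⟩)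
  refine lt_of_le_of_lt (iSup_le fun ε => iSup_le fun hε => iSup_le fun x => ?_)
    (ENNReal.mul_lt_top hTtop.lt_top hS'.lt_top)
  set z : ℂ := (E : ℂ) + (ε : ℂ) * Complex.I with hz
  have hzim : z.im ≠ 0 := by simp [hz, hε.ne']
  have hdecay : ∀ y, (∫⁻ ω, ‖green (hamiltonian V₀ (V ω) g) z x y‖ₑ ^ s ∂P) *
      ENNReal.ofReal (Real.exp (η * graphDist x y)) ≤ T := by
    intro y
    refine mul_exp_le_of_recursion (Γ := Γ) (m := M)
      (f := fun x => ∫⁻ ω, ‖green (hamiltonian V₀ (V ω) g) z x y‖ₑ ^ s ∂P)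
      (F := ENNReal.ofReal |z.im|⁻¹ ^ s) hη0.le (by rw [hη]; linarith)
      (ENNReal.rpow_ne_top_of_nonneg hs.le ENNReal.ofReal_ne_top) (fun u => ?_) hsum
      (fun u hu => hV.lintegral_green_le_neighborSum hs hs1.le hdec V₀ hg0 hzim hu y)
      (fun u hu => ?_) hsmall x
    · calc ∫⁻ ω, ‖green (hamiltonian V₀ (V ω) g) z u y‖ₑ ^ s ∂P
          ≤ ∫⁻ _, ENNReal.ofReal |z.im|⁻¹ ^ s ∂P := by
            refine lintegral_mono fun ω => ENNReal.rpow_le_rpow ?_ hs.le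
            rw [← ofReal_norm]
            exact ENNReal.ofReal_le_ofReal (norm_green_le _ hzim u y)
        _ = _ := by simp
    · obtain ⟨ρ, hρ, hρ'⟩ := helim ε hε u hu
      refine (hV.lintegral_green_le_tsum hs hs1.le V₀ g hzim y hρ').trans
        (ENNReal.tsum_le_tsum fun v => mul_le_mul_left ?_ _)
      have h1 : ‖ρ v‖ₑ ≤ ENNReal.ofReal C₁ * ENNReal.ofReal (Real.exp (-(m * graphDist u v))) := by
        rw [← ofReal_norm, ← ENNReal.ofReal_mul hC₁.le]
        exact ENNReal.ofReal_le_ofReal (hρ v)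
      refine (ENNReal.rpow_le_rpow h1 hs.le).trans (le_of_eq ?_)
      rw [ENNReal.mul_rpow_of_nonneg _ _ hs.le, ENNReal.ofReal_rpow_of_pos (Real.exp_pos _),
        ← Real.exp_mul, hM]
      congr 3
      ring
  calc ∑' y, (∫⁻ ω, ‖green (hamiltonian V₀ (V ω) g) z x y‖ₑ ^ s ∂P) *
        ENNReal.ofReal (Real.exp (η / 2 * graphDist x y))
      ≤ ∑' y, T * ENNReal.ofReal (Real.exp (-(η / 2 * graphDist x y))) := by
        refine ENNReal.tsum_le_tsum fun y => ?_
        have h1 : Real.exp (η / 2 * graphDist x y) =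
            Real.exp (η * graphDist x y) * Real.exp (-(η / 2 * graphDist x y)) := by
          rw [← Real.exp_add]
          congr 1
          ring
        rw [h1, ENNReal.ofReal_mul (Real.exp_pos _).le, ← mul_assoc]
        exact mul_le_mul_left (hdecay y) _
    _ = T * ∑' y, ENNReal.ofReal (Real.exp (-(η / 2 * graphDist x y))) := ENNReal.tsum_mul_left
    _ ≤ T * S' := mul_le_mul_right (hsum' x) _
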